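/- Let $p$ and $q$ be prime numbers with $p\equiv 5\pmod 8$, $q\equiv 3\pmod 8$ and Legendre symbol $\left(\frac{p}{q}\right)=1$. For a square-free integer $d>1$ let $\varepsilon_d>1$ denote the fundamental unit of the real quadratic field $\mathbb{Q}(\sqrt d)$, i.e. the least unit greater than $1$ of its ring of integers. A fundamental system of units of a number field $k$ is a family $(u_1,\dots,u_r)$ of units of its ring of integers such that every unit can be written in exactly one way as $\zeta u_1^{n_1}\cdots u_r^{n_r}$ with $\zeta$ a root of unity in $k$ and $n_1,\dots,n_r\in\mathbb{Z}$. All square roots are the positive real ones. Then: 1. A fundamental system of units of $\mathbb{Q}(\sqrt{p},\sqrt{q})$ is given by $\{\varepsilon_{p},\ \varepsilon_{q},\ \sqrt{\varepsilon_{pq}}\}$. 2. A fundamental system of units of $\mathbb{Q}(\sqrt{2},\sqrt{q})$ is given by $\{\varepsilon_{2},\ \sqrt{\varepsilon_{q}},\ \sqrt{\varepsilon_{2q}}\}$. 3. A fundamental system of units of $\mathbb{Q}(\sqrt{p},\sqrt{2q})$ is given by $\{\varepsilon_{p},\ \varepsilon_{2q},\ \sqrt{\varepsilon_{2q}\varepsilon_{2pq}}\}$.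 4. A fundamental system of units of $\mathbb{Q}(\sqrt{q},\sqrt{2p})$ is given by $\{\varepsilon_{q},\ \varepsilon_{2p},\ \sqrt{\varepsilon_{2pq}}\}$. 5. A fundamental system of units of $\mathbb{Q}(\sqrt{2},\sqrt{pq})$ is given by $\{\varepsilon_{2},\ \varepsilon_{pq},\ \sqrt{\varepsilon_{pq}\varepsilon_{2pq}}\}$. -/

import Mathlib

open scoped NumberField

/-- A finite family `u` of units of the ring of integers of `K` is a fundamental system of units:
every unit is, in exactly one way, a root of unity of `K` times a product of integer powers of
the members of `u`. -/
def IsFundamentalSystem (K : Type*) [Field K] {r : ℕ} (u : Fin r → (𝓞 K)ˣ) : Prop :=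
  ∀ x : (𝓞 K)ˣ, ∃! ζe : NumberField.Units.torsion K × (Fin r → ℤ),
    x = (ζe.1 : (𝓞 K)ˣ) * ∏ i, u i ^ ζe.2 i

/-- The real numbers `x 0, …, x (r - 1)` are units of (the ring of integers of) the real field `K`
and form a fundamental system of units of `K`. -/
def IsFSU (K : IntermediateField ℚ ℝ) {r : ℕ} (x : Fin r → ℝ) : Prop :=
  ∃ u : Fin r → (𝓞 K)ˣ, (∀ i, (((u i : 𝓞 K) : K) : ℝ) = x i) ∧ IsFundamentalSystem K u

/-- The real quadratic field `ℚ(√d)`, as a subfield of `ℝ`. -/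
noncomputable def quadraticField (d : ℕ) : IntermediateField ℚ ℝ :=
  IntermediateField.adjoin ℚ {√(d : ℝ)}

/-- The field `ℚ(√a, √b)`, as a subfield of `ℝ`. -/
noncomputable def biquadraticField (a b : ℕ) : IntermediateField ℚ ℝ :=
  IntermediateField.adjoin ℚ {√(a : ℝ), √(b : ℝ)}

/-- The fundamental unit `ε_d` of `ℚ(√d)` (for a squarefree `d > 1`): the least unit of its ring of
integers that exceeds `1`. -/
noncomputable def fundamentalUnit (d : ℕ) : ℝ :=
  sInf {x : ℝ | 1 < x ∧ ∃ u : (𝓞 (quadraticField d))ˣ, (((u : 𝓞 (quadraticField d)) :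
    quadraticField d) : ℝ) = x}

/-! Each of the five fields is K = ℚ(√a, √b), with fundamental units e₁, e₂, e₃ of its quadratic
subfields ℚ(√a), ℚ(√b), ℚ(√ab), arranged so that e₁ has norm -1 and e₂, e₃ have norm 1
(`BiquadraticData`). If y is a unit of K, and σ, τ are the conjugations fixing √a and √b, then y² =
(y·σy)(y·τy)/(σy·τy) is, up to sign, a product of powers of e₁, e₂, e₃ (`exists_sq_eq_zpow`).
Applying τ to this expression for y² gives a positive number, while τe₁ = -1/e₁, so the exponent of
e₁ is even (`BiquadraticData.exists_sq_eq`). It remains to know which of √e₂, √e₃, √(e₂e₃) lie in K.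

For e of norm 1 in ℚ(√d) with trace n + 2, one has (n + 4)n = ds², (n + 4)e = (e + 1)² and ne = (e -
1)². Hence, if δ is the squarefree part of n or of n + 4, then √δ·√e lies in ℚ(√d)
(`IsFundamentalUnit.sqrt_mul_sqrt_mem`), while √e does not, by minimality of e. A prime factor of δ
divides d or is 2. If p divides d, it divides one of n, n + 4, and the other is ±4 mod p, a nonzero
square; as q is a square mod p and 2 is not, δ is 1 or q (`exists_factor_eq_sq`). This gives √q·√e ∈
ℚ(√d) for d = pq, 2pq, and norm -1 for d = p, 2p. For d = q, 2q the same argument without p yields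
√2·√e ∈ ℚ(√d) (`sqrt_two_mul_sqrt_mem`). So √ε_q and √ε_2q behave like √2, and √ε_pq and √ε_2pq like
√q; each case then asks whether √2, √q or √(2q) lies in K (`isSquare_of_sqrt_mem`). -/

/-! ### Units of real fields as real numbers -/

/-- `x` is (the real value of) a unit of the ring of integers of the real field `K`. -/
def IsUnitIn (K : IntermediateField ℚ ℝ) (x : ℝ) : Prop :=
  x ∈ K ∧ x ≠ 0 ∧ IsIntegral ℤ x ∧ IsIntegral ℤ x⁻¹

namespace IsUnitIn

variable {K L : IntermediateField ℚ ℝ} {x y : ℝ}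

lemma one : IsUnitIn K 1 := ⟨one_mem K, one_ne_zero, isIntegral_one, by simpa using isIntegral_one⟩

lemma mul (hx : IsUnitIn K x) (hy : IsUnitIn K y) : IsUnitIn K (x * y) :=
  ⟨mul_mem hx.1 hy.1, mul_ne_zero hx.2.1 hy.2.1, hx.2.2.1.mul hy.2.2.1, by
    rw [mul_inv]; exact hx.2.2.2.mul hy.2.2.2⟩

lemma inv (hx : IsUnitIn K x) : IsUnitIn K x⁻¹ :=
  ⟨inv_mem hx.1, inv_ne_zero hx.2.1, hx.2.2.2, by rw [inv_inv]; exact hx.2.2.1⟩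

lemma neg (hx : IsUnitIn K x) : IsUnitIn K (-x) :=
  ⟨neg_mem hx.1, neg_ne_zero.2 hx.2.1, hx.2.2.1.neg, by rw [inv_neg]; exact hx.2.2.2.neg⟩

lemma div (hx : IsUnitIn K x) (hy : IsUnitIn K y) : IsUnitIn K (x / y) := by
  rw [div_eq_mul_inv]; exact hx.mul hy.inv

lemma pow (hx : IsUnitIn K x) : ∀ n : ℕ, IsUnitIn K (x ^ n)
  | 0 => by simpa using one
  | n + 1 => by rw [pow_succ]; exact (hx.pow n).mul hx

lemma zpow (hx : IsUnitIn K x) : ∀ n : ℤ, IsUnitIn K (x ^ n)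
  | (n : ℕ) => by rw [zpow_natCast]; exact hx.pow n
  | Int.negSucc n => by rw [zpow_negSucc]; exact (hx.pow _).inv

lemma mono (h : K ≤ L) (hx : IsUnitIn K x) : IsUnitIn L x := ⟨h hx.1, hx.2⟩

/-- Integrality of x and x⁻¹ follows from that of their squares, so x² may be known as a unit of a
different field. -/
lemma of_sq (hm : x ∈ K) (h : IsUnitIn L (x ^ 2)) : IsUnitIn K x :=
  ⟨hm, fun h0 => h.2.1 (by simp [h0]), (IsIntegral.pow_iff two_pos).1 h.2.2.1,
    (IsIntegral.pow_iff two_pos).1 (by rw [inv_pow]; exact h.2.2.2)⟩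

lemma sqrt (hx : IsUnitIn L x) (h0 : 0 < x) (hm : √x ∈ K) : IsUnitIn K √x :=
  of_sq hm (L := L) (by rwa [Real.sq_sqrt h0.le])

end IsUnitIn

lemma IntermediateField.isIntegral_coe_iff {K : IntermediateField ℚ ℝ} {x : K} :
    IsIntegral ℤ (x : ℝ) ↔ IsIntegral ℤ x :=
  isIntegral_algHom_iff (K.val.restrictScalars ℤ) K.val.injective

lemma isUnitIn_iff_exists_units {K : IntermediateField ℚ ℝ} {x : ℝ} :
    (∃ u : (𝓞 K)ˣ, ((u : 𝓞 K) : K) = x) ↔ IsUnitIn K x := by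
  constructor
  · rintro ⟨u, rfl⟩
    have h : ((((u⁻¹ : (𝓞 K)ˣ) : 𝓞 K) : K) : ℝ) = (((u : 𝓞 K) : K) : ℝ)⁻¹ := by
      apply eq_inv_of_mul_eq_one_left
      norm_cast
      simp
    refine ⟨SetLike.coe_mem _, ?_, ?_, ?_⟩
    · simp
    · exact IntermediateField.isIntegral_coe_iff.2 (NumberField.RingOfIntegers.isIntegral_coe _)
    · rw [← h]
      exact IntermediateField.isIntegral_coe_iff.2 (NumberField.RingOfIntegers.isIntegral_coe _)
  · rintro ⟨h1, h2, h3, h4⟩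
    have h3' : IsIntegral ℤ (⟨x, h1⟩ : K) := IntermediateField.isIntegral_coe_iff.1 h3
    have h4' : IsIntegral ℤ (⟨x⁻¹, inv_mem h1⟩ : K) := IntermediateField.isIntegral_coe_iff.1 h4
    refine ⟨⟨⟨⟨x, h1⟩, h3'⟩, ⟨⟨x⁻¹, inv_mem h1⟩, h4'⟩, ?_, ?_⟩, rfl⟩
    · apply NumberField.RingOfIntegers.ext
      apply Subtype.ext
      exact mul_inv_cancel₀ h2
    · apply NumberField.RingOfIntegers.ext
      apply Subtype.ext
      exact inv_mul_cancel₀ h2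

/-- The real value of a unit of a real field, as a group homomorphism. -/
noncomputable def unitValue (K : IntermediateField ℚ ℝ) : (𝓞 K)ˣ →* ℝˣ :=
  Units.map ((K.val : K →+* ℝ).comp (algebraMap (𝓞 K) K) : 𝓞 K →* ℝ)

lemma unitValue_apply {K : IntermediateField ℚ ℝ} (u : (𝓞 K)ˣ) :
    (unitValue K u : ℝ) = ((u : 𝓞 K) : K) := rfl

lemma unitValue_injective (K : IntermediateField ℚ ℝ) : Function.Injective (unitValue K) := by
  intro u v h
  have h' := congrArg Units.val h
  rw [unitValue_apply, unitValue_apply] at h'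
  exact Units.ext (NumberField.RingOfIntegers.ext (Subtype.ext h'))

/-- Positive units that generate the positive units and are multiplicatively independent form a
fundamental system. -/
theorem isFSU_of_pos {K : IntermediateField ℚ ℝ} {r : ℕ} {x : Fin r → ℝ}
    (hx : ∀ i, IsUnitIn K (x i)) (hpos : ∀ i, 0 < x i)
    (hgen : ∀ y, IsUnitIn K y → 0 < y → ∃ n : Fin r → ℤ, y = ∏ i, x i ^ n i)
    (hind : ∀ n : Fin r → ℤ, ∏ i, x i ^ n i = 1 → n = 0) : IsFSU K x := by
  choose u hu using fun i => isUnitIn_iff_exists_units.2 (hx i)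
  have hprod (n : Fin r → ℤ) : (unitValue K (∏ i, u i ^ n i) : ℝ) = ∏ i, x i ^ n i := by
    simp [map_prod, unitValue_apply, hu]
  have hppos (n : Fin r → ℤ) : 0 < ∏ i, x i ^ n i :=
    Finset.prod_pos fun i _ => zpow_pos (hpos i) _
  refine ⟨u, hu, fun y => ?_⟩
  have hy : IsUnitIn K (unitValue K y) := isUnitIn_iff_exists_units.1 ⟨y, rfl⟩
  have hneg : (-1 : (𝓞 K)ˣ) ∈ NumberField.Units.torsion K :=
    isOfFinOrder_iff_pow_eq_one.2 ⟨2, two_pos, by simp⟩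
  -- The field is real, so its only roots of unity are ±1.
  have htor (ζ : NumberField.Units.torsion K) :
      (unitValue K ζ : ℝ) = 1 ∨ (unitValue K ζ : ℝ) = -1 := by
    obtain ⟨n, hn, h⟩ := isOfFinOrder_iff_pow_eq_one.1 ζ.2
    have h' : (unitValue K ζ : ℝ) ^ n = 1 := by
      rw [← Units.val_pow_eq_pow_val, ← map_pow, h]; simp
    have h2 : |(unitValue K ζ : ℝ)| ^ n = 1 := by rw [← abs_pow, h', abs_one]
    have h3 := (pow_eq_one_iff_of_nonneg (abs_nonneg _) hn.ne').1 h2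
    exact eq_or_eq_neg_of_abs_eq h3
  obtain ⟨ζ, n, h⟩ : ∃ (ζ : NumberField.Units.torsion K) (n : Fin r → ℤ),
      y = (ζ : (𝓞 K)ˣ) * ∏ i, u i ^ n i := by
    rcases lt_or_gt_of_ne hy.2.1 with h0 | h0
    · obtain ⟨n, hn⟩ := hgen _ hy.neg (neg_pos.2 h0)
      refine ⟨⟨-1, hneg⟩, n, unitValue_injective K (Units.ext ?_)⟩
      rw [map_mul, Units.val_mul, hprod, ← hn]
      simp [unitValue_apply]
    · obtain ⟨n, hn⟩ := hgen _ hy h0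
      refine ⟨1, n, unitValue_injective K (Units.ext ?_)⟩
      rw [map_mul, Units.val_mul, hprod, ← hn]
      simp
  refine ⟨(ζ, n), h, ?_⟩
  rintro ⟨ζ', n'⟩ h'
  simp only at h'
  -- Absolute values remove the roots of unity and reduce uniqueness to independence.
  have e := congrArg (fun v => |(unitValue K v : ℝ)|) (h.symm.trans h')
  simp only [map_mul, Units.val_mul, hprod, abs_mul, abs_of_pos (hppos _)] at e
  have habs (ζ : NumberField.Units.torsion K) : |(unitValue K ζ : ℝ)| = 1 := by
    rcases htor ζ with h | h <;> simp [h]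
  rw [habs, habs, one_mul, one_mul] at e
  have hn : n' - n = 0 := by
    apply hind
    have : ∏ i, x i ^ (n' - n) i = (∏ i, x i ^ n' i) / ∏ i, x i ^ n i := by
      rw [← Finset.prod_div_distrib]
      exact Finset.prod_congr rfl fun i _ => by rw [Pi.sub_apply, zpow_sub₀ (hpos i).ne']
    rw [this, ← e, div_self (hppos n).ne']
  have hn' : n' = n := sub_eq_zero.1 hn
  subst hn'
  have : ζ' = ζ := Subtype.ext (mul_right_cancel (h'.symm.trans h))
  rw [this]

/-! ### Coordinates and conjugations in ℚ(√d) and ℚ(√a, √b) -/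

lemma natCast_sqrt_mul_self (d : ℕ) : √(d : ℝ) * √(d : ℝ) = d :=
  Real.mul_self_sqrt (Nat.cast_nonneg d)

lemma isIntegral_sqrt_natCast (d : ℕ) : IsIntegral ℚ √(d : ℝ) :=
  (IsIntegral.pow_iff two_pos).1 (by
    rw [Real.sq_sqrt (Nat.cast_nonneg d)]; exact isIntegral_algebraMap (R := ℚ) (x := (d : ℚ)))

lemma sqrt_mem_quadraticField (d : ℕ) : √(d : ℝ) ∈ quadraticField d :=
  IntermediateField.subset_adjoin _ _ rfl

lemma sqrt_mem_biquadraticField_left (a b : ℕ) : √(a : ℝ) ∈ biquadraticField a b :=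
  IntermediateField.subset_adjoin _ _ (by simp)

lemma sqrt_mem_biquadraticField_right (a b : ℕ) : √(b : ℝ) ∈ biquadraticField a b :=
  IntermediateField.subset_adjoin _ _ (by simp)

lemma ratCast_mem_field (K : IntermediateField ℚ ℝ) (r : ℚ) : (r : ℝ) ∈ K := K.algebraMap_mem r

lemma biquadraticField_comm (a b : ℕ) : biquadraticField a b = biquadraticField b a := by
  rw [biquadraticField, biquadraticField, Set.pair_comm]

lemma quadraticField_le {d : ℕ} {K : IntermediateField ℚ ℝ} (h : √(d : ℝ) ∈ K) :
    quadraticField d ≤ K :=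
  IntermediateField.adjoin_le_iff.2 (by simpa using h)

lemma mem_biquadraticField {a b : ℕ} {x : ℝ} (hx : x ∈ biquadraticField a b) :
    ∃ r s t u : ℚ, x = r + s * √(a : ℝ) + t * √(b : ℝ) + u * (√(a : ℝ) * √(b : ℝ)) := by
  have hx' : x ∈ Algebra.adjoin ℚ {√(a : ℝ), √(b : ℝ)} := by
    rw [← IntermediateField.adjoin_toSubalgebra_of_isAlgebraic]
    · exact hx
    · rintro y (rfl | rfl)
      · exact (isIntegral_sqrt_natCast a).isAlgebraic
      · exact (isIntegral_sqrt_natCast b).isAlgebraic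
  induction hx' using Algebra.adjoin_induction with
  | mem y hy =>
    rcases hy with rfl | rfl
    · exact ⟨0, 1, 0, 0, by simp⟩
    · exact ⟨0, 0, 1, 0, by simp⟩
  | algebraMap r => exact ⟨r, 0, 0, 0, by simp⟩
  | add y z hy hz h1 h2 =>
    obtain ⟨r, s, t, u, rfl⟩ := h1 (by
      rw [biquadraticField]; exact IntermediateField.algebra_adjoin_le_adjoin _ _ hy)
    obtain ⟨r', s', t', u', rfl⟩ := h2 (by
      rw [biquadraticField]; exact IntermediateField.algebra_adjoin_le_adjoin _ _ hz)
    exact ⟨r + r', s + s', t + t', u + u', by push_cast; ring⟩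
  | mul y z hy hz h1 h2 =>
    obtain ⟨r, s, t, u, rfl⟩ := h1 (by
      rw [biquadraticField]; exact IntermediateField.algebra_adjoin_le_adjoin _ _ hy)
    obtain ⟨r', s', t', u', rfl⟩ := h2 (by
      rw [biquadraticField]; exact IntermediateField.algebra_adjoin_le_adjoin _ _ hz)
    refine ⟨r * r' + a * s * s' + b * t * t' + a * b * u * u',
      r * s' + s * r' + b * t * u' + b * u * t', r * t' + t * r' + a * s * u' + a * u * s',
      r * u' + u * r' + s * t' + t * s', ?_⟩
    push_cast
    have ha := natCast_sqrt_mul_self a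
    have hb := natCast_sqrt_mul_self b
    generalize √(a : ℝ) = A at *
    generalize √(b : ℝ) = B at *
    rw [← ha, ← hb]
    ring

lemma mem_quadraticField {d : ℕ} {x : ℝ} (hx : x ∈ quadraticField d) :
    ∃ r s : ℚ, x = r + s * √(d : ℝ) := by
  have h : x ∈ biquadraticField d 0 := quadraticField_le (sqrt_mem_biquadraticField_left d 0) hx
  obtain ⟨r, s, t, u, rfl⟩ := mem_biquadraticField h
  exact ⟨r, s, by simp⟩

lemma add_mul_sqrt_mem_quadraticField (d : ℕ) (r s : ℚ) : r + s * √(d : ℝ) ∈ quadraticField d :=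
  add_mem (ratCast_mem_field _ r) (mul_mem (ratCast_mem_field _ s) (sqrt_mem_quadraticField d))

open IntermediateField in
/-- The conjugation of `F(√c)` over `F`, on any field between `ℚ` and `F(√c)`. -/
lemma exists_conj (F K : IntermediateField ℚ ℝ) (c : ℕ) (hc : √(c : ℝ) ∉ F)
    (hK : ∀ x ∈ K, ∃ α ∈ F, ∃ β ∈ F, x = α + β * √(c : ℝ)) :
    ∃ σ : K →ₐ[ℚ] ℝ, ∀ k : K, ∀ α ∈ F, ∀ β ∈ F, (k : ℝ) = α + β * √(c : ℝ) →
      σ k = α - β * √(c : ℝ) := by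
  have hcF : (c : ℝ) ∈ F := _root_.natCast_mem F c
  have hirr : Irreducible (Polynomial.X ^ 2 - Polynomial.C (⟨c, hcF⟩ : F)) := by
    apply X_pow_sub_C_irreducible_of_prime Nat.prime_two
    intro b hb
    have hb' : (b : ℝ) ^ 2 = c := congrArg Subtype.val hb
    apply hc
    rw [← hb', Real.sqrt_sq_eq_abs]
    rcases abs_choice (b : ℝ) with h | h <;> rw [h]
    · exact b.2
    · exact neg_mem b.2
  have hroot (y : ℝ) (hy : y ^ 2 = c) :
      Polynomial.aeval y (Polynomial.X ^ 2 - Polynomial.C (⟨c, hcF⟩ : F)) = 0 := by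
    simp only [map_sub, map_pow, Polynomial.aeval_X, Polynomial.aeval_C, hy]
    exact sub_self _
  have hsq : √(c : ℝ) ^ 2 = c := Real.sq_sqrt (Nat.cast_nonneg c)
  have hmin := minpoly.eq_of_irreducible_of_monic hirr (hroot _ hsq)
    (Polynomial.monic_X_pow_sub_C _ two_ne_zero)
  have hint : IsIntegral F √(c : ℝ) :=
    ⟨_, Polynomial.monic_X_pow_sub_C (⟨c, hcF⟩ : F) two_ne_zero, hroot _ hsq⟩
  have hmem : -√(c : ℝ) ∈ (minpoly F √(c : ℝ)).aroots ℝ := by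
    rw [Polynomial.mem_aroots, ← hmin]
    exact ⟨hirr.ne_zero, hroot _ (by rw [neg_sq, hsq])⟩
  let τ := (algHomAdjoinIntegralEquiv F hint).symm ⟨_, hmem⟩
  have hτ : τ (AdjoinSimple.gen F √(c : ℝ)) = -√(c : ℝ) :=
    algHomAdjoinIntegralEquiv_symm_apply_gen F hint ⟨_, hmem⟩
  have hF (α : ℝ) (hα : α ∈ F) : α ∈ F⟮√(c : ℝ)⟯ := F⟮√(c : ℝ)⟯.algebraMap_mem ⟨α, hα⟩
  -- The conjugation is built on all of F(√c) and then restricted; K need not contain F.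
  have hle : K ≤ restrictScalars ℚ F⟮√(c : ℝ)⟯ := by
    intro x hx
    obtain ⟨α, hα, β, hβ, rfl⟩ := hK x hx
    exact add_mem (hF α hα) (mul_mem (hF β hβ) (mem_adjoin_simple_self F _))
  refine ⟨(τ.restrictScalars ℚ).comp (inclusion hle), fun k α hα β hβ h => ?_⟩
  have key (w : F⟮√(c : ℝ)⟯) (hw : (w : ℝ) = α + β * √(c : ℝ)) : τ w = α - β * √(c : ℝ) := by
    have hw' : w = algebraMap F _ ⟨α, hα⟩ + algebraMap F _ ⟨β, hβ⟩ * AdjoinSimple.gen F √(c : ℝ) :=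
      Subtype.ext hw
    rw [hw', map_add, map_mul, hτ, τ.commutes, τ.commutes, mul_neg, ← sub_eq_add_neg]
    rfl
  exact key (inclusion hle k) h

/-- A field embedding preserves units. -/
lemma IsUnitIn.isIntegral_map {K : IntermediateField ℚ ℝ} (σ : K →ₐ[ℚ] ℝ) {x : ℝ}
    (hx : IsUnitIn K x) : IsIntegral ℤ (σ ⟨x, hx.1⟩) ∧ IsIntegral ℤ (σ ⟨x, hx.1⟩)⁻¹ := by
  refine ⟨(IntermediateField.isIntegral_coe_iff.1 hx.2.2.1).map (σ.restrictScalars ℤ), ?_⟩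
  rw [← map_inv₀]
  exact (IntermediateField.isIntegral_coe_iff.1 hx.2.2.2).map (σ.restrictScalars ℤ)

/-! ### Fundamental units of real quadratic fields -/

/-- `e` is the least unit exceeding `1` of the ring of integers of `ℚ(√d)`. -/
def IsFundamentalUnit (d : ℕ) (e : ℝ) : Prop :=
  IsLeast {x : ℝ | 1 < x ∧ IsUnitIn (quadraticField d) x} e

lemma mem_bot_iff_ratCast {x : ℝ} : x ∈ (⊥ : IntermediateField ℚ ℝ) ↔ ∃ r : ℚ, (r : ℝ) = x :=
  IntermediateField.mem_bot

lemma sqrt_natCast_ne_ratCast {d : ℕ} (hd : ¬IsSquare d) (r : ℚ) : √(d : ℝ) ≠ r :=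
  fun h => irrational_sqrt_natCast_iff.2 hd ⟨r, h.symm⟩

lemma exists_int_of_isIntegral_ratCast {r : ℚ} (h : IsIntegral ℤ (r : ℝ)) : ∃ n : ℤ, r = n := by
  have h' : IsIntegral ℤ r :=
    (isIntegral_algHom_iff ((Algebra.ofId ℚ ℝ).restrictScalars ℤ)
      (algebraMap ℚ ℝ).injective).1 h
  obtain ⟨n, hn⟩ := IsIntegrallyClosed.isIntegral_iff.1 h'
  exact ⟨n, by rw [← hn]; rfl⟩

/-- The conjugation of a real quadratic field. -/
lemma exists_conj_quadraticField {d : ℕ} (hd : ¬IsSquare d) :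
    ∃ σ : quadraticField d →ₐ[ℚ] ℝ, ∀ (k : quadraticField d) (r s : ℚ),
      (k : ℝ) = r + s * √(d : ℝ) → σ k = r - s * √(d : ℝ) := by
  obtain ⟨σ, hσ⟩ := exists_conj ⊥ (quadraticField d) d
    (fun h => by
      obtain ⟨r, hr⟩ := mem_bot_iff_ratCast.1 h
      exact sqrt_natCast_ne_ratCast hd r hr.symm)
    (fun x hx => by
      obtain ⟨r, s, h⟩ := mem_quadraticField hx
      exact ⟨r, ratCast_mem_field _ r, s, ratCast_mem_field _ s, h⟩)
  exact ⟨σ, fun k r s h => hσ k r (ratCast_mem_field _ r) s (ratCast_mem_field _ s) h⟩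

/-- Units of a real quadratic field have integral trace and norm `±1`. -/
lemma IsUnitIn.exists_coords {d : ℕ} (hd : ¬IsSquare d) {x : ℝ}
    (hx : IsUnitIn (quadraticField d) x) : ∃ r s : ℚ, x = r + s * √(d : ℝ) ∧
      (r ^ 2 - d * s ^ 2 = 1 ∨ r ^ 2 - d * s ^ 2 = -1) ∧ ∃ t : ℤ, 2 * r = t := by
  obtain ⟨σ, hσ⟩ := exists_conj_quadraticField hd
  obtain ⟨r, s, h⟩ := mem_quadraticField hx.1
  obtain ⟨h1, h2⟩ := hx.isIntegral_map σ
  rw [hσ _ r s h] at h1 h2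
  have hsq : √(d : ℝ) ^ 2 = d := Real.sq_sqrt (Nat.cast_nonneg d)
  have hn : x * (r - s * √(d : ℝ)) = ((r ^ 2 - d * s ^ 2 : ℚ) : ℝ) := by
    rw [h]; push_cast; linear_combination (-(s : ℝ) ^ 2) * hsq
  have ht : x + (r - s * √(d : ℝ)) = ((2 * r : ℚ) : ℝ) := by rw [h]; push_cast; ring
  obtain ⟨t, ht⟩ := exists_int_of_isIntegral_ratCast (ht ▸ hx.2.2.1.add h1)
  obtain ⟨m, hm⟩ := exists_int_of_isIntegral_ratCast (hn ▸ hx.2.2.1.mul h1)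
  have hinv : x⁻¹ * (r - s * √(d : ℝ))⁻¹ = (((r ^ 2 - d * s ^ 2)⁻¹ : ℚ) : ℝ) := by
    rw [← mul_inv, hn, Rat.cast_inv]
  obtain ⟨m', hm'⟩ := exists_int_of_isIntegral_ratCast (hinv ▸ hx.2.2.2.mul h2)
  have h0 : r ^ 2 - d * s ^ 2 ≠ 0 := by
    intro h0
    rw [h0, Rat.cast_zero, mul_eq_zero] at hn
    rcases hn with hn | hn
    · exact hx.2.1 hn
    · have h3 : σ ⟨x, hx.1⟩ = 0 := by rw [hσ _ r s h, hn]
      rw [map_eq_zero] at h3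
      exact hx.2.1 (congrArg Subtype.val h3)
  have hmm : m * m' = 1 := by
    have : (m : ℚ) * m' = 1 := by rw [← hm, ← hm', mul_inv_cancel₀ h0]
    exact_mod_cast this
  refine ⟨r, s, h, ?_, t, ht⟩
  rcases Int.eq_one_or_neg_one_of_mul_eq_one hmm with h | h <;> rw [hm, h] <;> simp

/-- A nontrivial solution of Pell's equation, made positive, is such a unit; its inverse is its
conjugate. -/
lemma exists_one_lt_isUnitIn {d : ℕ} (hd : ¬IsSquare d) :
    ∃ x, 1 < x ∧ IsUnitIn (quadraticField d) x := by
  have hd0 : d ≠ 0 := by rintro rfl; exact hd ⟨0, rfl⟩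
  obtain ⟨a, b, h, hb⟩ := Pell.exists_of_not_isSquare (d := d) (by positivity)
    (fun h => hd (by exact_mod_cast h))
  have hsq : √(d : ℝ) ^ 2 = d := Real.sq_sqrt (Nat.cast_nonneg d)
  have hint : IsIntegral ℤ √(d : ℝ) := (IsIntegral.pow_iff two_pos).1 (by
    rw [hsq]; exact isIntegral_algebraMap (R := ℤ) (x := (d : ℤ)))
  have hz (n : ℤ) : IsIntegral ℤ (n : ℝ) := isIntegral_algebraMap (R := ℤ) (x := n)
  have hmul : ((|a| : ℤ) + (|b| : ℤ) * √(d : ℝ)) * ((|a| : ℤ) - (|b| : ℤ) * √(d : ℝ)) = 1 := by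
    have h' : (((|a| : ℤ) : ℝ)) ^ 2 - d * ((|b| : ℤ) : ℝ) ^ 2 = 1 := by
      have : |a| ^ 2 - d * |b| ^ 2 = 1 := by rw [sq_abs, sq_abs]; exact h
      exact_mod_cast this
    linear_combination h' - ((|b| : ℤ) : ℝ) ^ 2 * hsq
  have ha : (1 : ℝ) ≤ (|a| : ℤ) := by
    have : a ≠ 0 := by
      rintro rfl
      have : 0 ≤ (d : ℤ) * b ^ 2 := by positivity
      linarith
    exact_mod_cast Int.one_le_abs this
  have hb' : (1 : ℝ) ≤ (|b| : ℤ) := by exact_mod_cast Int.one_le_abs hb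
  have hs : 0 < √(d : ℝ) := Real.sqrt_pos.2 (by positivity)
  refine ⟨(|a| : ℤ) + (|b| : ℤ) * √(d : ℝ), by nlinarith, ?_, left_ne_zero_of_mul_eq_one hmul,
    (hz _).add ((hz _).mul hint), ?_⟩
  · have := add_mul_sqrt_mem_quadraticField d (|a| : ℤ) (|b| : ℤ)
    exact_mod_cast this
  · rw [inv_eq_of_mul_eq_one_right hmul]
    exact (hz _).sub ((hz _).mul hint)

/-- A unit x is a root of X² - tX + n with t an integer and n = ±1. Its conjugate t - x has absolute
value below 1, so t is bounded, and x is the larger root. -/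
lemma finite_isUnitIn_Ioc {d : ℕ} (hd : ¬IsSquare d) (M : ℝ) :
    {x : ℝ | 1 < x ∧ IsUnitIn (quadraticField d) x ∧ x ≤ M}.Finite := by
  refine ((Set.finite_Icc (-(⌈M⌉ + 1)) (⌈M⌉ + 1)).image2
    (fun (t n : ℤ) => ((t : ℝ) + √((t : ℝ) ^ 2 - 4 * n)) / 2)
    (Set.toFinite {1, -1})).subset ?_
  rintro x ⟨h1, hx, hM⟩
  obtain ⟨r, s, h, hn, t, ht⟩ := hx.exists_coords hd
  obtain ⟨n, hn1, hn⟩ : ∃ n : ℤ, n ∈ ({1, -1} : Set ℤ) ∧ r ^ 2 - d * s ^ 2 = n := by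
    rcases hn with h | h
    · exact ⟨1, by simp, by simpa using h⟩
    · exact ⟨-1, by simp, by simpa using h⟩
  have hsq : √(d : ℝ) ^ 2 = d := Real.sq_sqrt (Nat.cast_nonneg d)
  have hn' : x * (t - x) = n := by
    have hnR : (r : ℝ) ^ 2 - d * (s : ℝ) ^ 2 = n := by exact_mod_cast hn
    have htR : 2 * (r : ℝ) = t := by exact_mod_cast ht
    rw [← htR, h]
    linear_combination hnR - (s : ℝ) ^ 2 * hsq
  have habs : |(t : ℝ) - x| < 1 := by
    have h2 : |x| * |(t : ℝ) - x| = 1 := by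
      rw [← abs_mul, hn']
      rcases hn1 with rfl | rfl <;> simp
    rw [abs_of_pos (by linarith)] at h2
    by_contra! h3
    nlinarith
  obtain ⟨h3, h4⟩ := abs_lt.1 habs
  have hc := Int.le_ceil M
  refine ⟨t, ⟨?_, ?_⟩, n, hn1, ?_⟩
  · have : -((⌈M⌉ : ℝ) + 1) ≤ t := by linarith
    exact_mod_cast this
  · have : (t : ℝ) ≤ ⌈M⌉ + 1 := by linarith
    exact_mod_cast this
  · have h5 : (t : ℝ) ^ 2 - 4 * n = (2 * x - t) ^ 2 := by rw [← hn']; ring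
    simp only [h5]
    rw [Real.sqrt_sq (by linarith)]
    ring

lemma isFundamentalUnit_fundamentalUnit {d : ℕ} (hd : ¬IsSquare d) :
    IsFundamentalUnit d (fundamentalUnit d) := by
  obtain ⟨y, hy1, hy⟩ := exists_one_lt_isUnitIn hd
  obtain ⟨e, ⟨he1, he, hey⟩, hmin⟩ := Set.exists_min_image _ id (finite_isUnitIn_Ioc hd y)
    ⟨y, hy1, hy, le_rfl⟩
  have hl : IsFundamentalUnit d e := by
    refine ⟨⟨he1, he⟩, fun x hx => ?_⟩
    rcases le_total x y with h | h
    · exact hmin x ⟨hx.1, hx.2, h⟩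
    · exact hey.trans h
  have hset : {x : ℝ | 1 < x ∧ ∃ u : (𝓞 (quadraticField d))ˣ, (((u : 𝓞 (quadraticField d)) :
      quadraticField d) : ℝ) = x} = {x : ℝ | 1 < x ∧ IsUnitIn (quadraticField d) x} :=
    Set.ext fun x => and_congr_right fun _ => isUnitIn_iff_exists_units
  have : fundamentalUnit d = e := by
    rw [fundamentalUnit, hset]
    exact IsLeast.csInf_eq hl
  rw [this]; exact hl

namespace IsFundamentalUnit

variable {d : ℕ} {e : ℝ}

lemma one_lt (h : IsFundamentalUnit d e) : 1 < e := h.1.1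

lemma pos (h : IsFundamentalUnit d e) : 0 < e := zero_lt_one.trans h.1.1

lemma isUnitIn (h : IsFundamentalUnit d e) : IsUnitIn (quadraticField d) e := h.1.2

/-- Dividing x by the largest power of e not exceeding it leaves a unit in [1, e), which is 1 by
minimality. -/
lemma exists_zpow (h : IsFundamentalUnit d e) {x : ℝ} (hx : IsUnitIn (quadraticField d) x)
    (h0 : 0 < x) : ∃ n : ℤ, x = e ^ n := by
  obtain ⟨n, h1, h2⟩ := exists_mem_Ico_zpow h0 h.one_lt
  refine ⟨n, ?_⟩
  have hp : 0 < e ^ n := zpow_pos h.pos n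
  by_contra hne
  have hlt : 1 < x / e ^ n := (one_lt_div hp).2 (lt_of_le_of_ne h1 (Ne.symm hne))
  have := h.2 ⟨hlt, hx.div (h.isUnitIn.zpow n)⟩
  rw [le_div_iff₀ hp, ← zpow_one_add₀ h.pos.ne', add_comm] at this
  linarith

/-- Otherwise √e would be a unit strictly between 1 and e. -/
lemma sqrt_notMem (h : IsFundamentalUnit d e) : √e ∉ quadraticField d := by
  intro hm
  have h1 : 1 < √e := by
    rw [Real.lt_sqrt zero_le_one, one_pow]
    exact h.one_lt
  have h2 := h.2 ⟨h1, h.isUnitIn.sqrt h.pos hm⟩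
  have h3 := Real.sq_sqrt h.pos.le
  nlinarith

end IsFundamentalUnit

/-- The unit `e` of `ℚ(√d)` has norm `n`. -/
def HasNorm (d : ℕ) (e : ℝ) (n : ℚ) : Prop :=
  ∃ r s : ℚ, e = r + s * √(d : ℝ) ∧ r ^ 2 - d * s ^ 2 = n

lemma HasNorm.conj {d : ℕ} {e : ℝ} {n : ℚ} (h : HasNorm d e n) {K : IntermediateField ℚ ℝ}
    (σ : K →ₐ[ℚ] ℝ) (hm : √(d : ℝ) ∈ K) (hσ : σ ⟨_, hm⟩ = -√(d : ℝ)) (he : e ∈ K) (h0 : e ≠ 0) :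
    σ ⟨e, he⟩ = n * e⁻¹ := by
  obtain ⟨r, s, rfl, h⟩ := h
  have hsq : √(d : ℝ) ^ 2 = d := Real.sq_sqrt (Nat.cast_nonneg d)
  have hk : (⟨r + s * √(d : ℝ), he⟩ : K) = algebraMap ℚ K r + algebraMap ℚ K s * ⟨_, hm⟩ :=
    Subtype.ext rfl
  rw [hk, map_add, map_mul, hσ, σ.commutes, σ.commutes, eq_mul_inv_iff_mul_eq₀ h0, ← h]
  simp only [eq_ratCast]
  push_cast
  linear_combination (-(s : ℝ) ^ 2) * hsq

lemma map_eq_self_of_mem_quadraticField {d : ℕ} {e : ℝ} (h : e ∈ quadraticField d)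
    {K : IntermediateField ℚ ℝ} (σ : K →ₐ[ℚ] ℝ) (hm : √(d : ℝ) ∈ K) (hσ : σ ⟨_, hm⟩ = √(d : ℝ))
    (he : e ∈ K) : σ ⟨e, he⟩ = e := by
  obtain ⟨r, s, rfl⟩ := mem_quadraticField h
  have hk : (⟨r + s * √(d : ℝ), he⟩ : K) = algebraMap ℚ K r + algebraMap ℚ K s * ⟨_, hm⟩ :=
    Subtype.ext rfl
  rw [hk, map_add, map_mul, hσ, σ.commutes, σ.commutes]
  rfl

lemma sqrt_notMem_quadraticField {a b : ℕ} (ha : ¬IsSquare a) (hb : ¬IsSquare b)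
    (hab : ¬IsSquare (a * b)) : √(b : ℝ) ∉ quadraticField a := by
  intro hm
  obtain ⟨r, s, h⟩ := mem_quadraticField hm
  have hA := natCast_sqrt_mul_self a
  have hB := natCast_sqrt_mul_self b
  by_cases hr : r = 0
  · apply sqrt_natCast_ne_ratCast hab (a * s)
    rw [Nat.cast_mul, Real.sqrt_mul (Nat.cast_nonneg a), h, hr]
    push_cast
    linear_combination (s : ℝ) * hA
  by_cases hs : s = 0
  · exact sqrt_natCast_ne_ratCast hb r (by rw [h, hs]; simp)
  apply sqrt_natCast_ne_ratCast ha ((b - r ^ 2 - a * s ^ 2) / (2 * r * s))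
  have hr' : (r : ℝ) ≠ 0 := by exact_mod_cast hr
  have hs' : (s : ℝ) ≠ 0 := by exact_mod_cast hs
  push_cast
  rw [eq_div_iff (by positivity)]
  rw [h] at hB
  linear_combination hB - (s : ℝ) ^ 2 * hA

lemma eq_zero_of_add_mul_sqrt_eq_zero {d : ℕ} (hd : ¬IsSquare d) {r s : ℚ}
    (h : (r : ℝ) + s * √(d : ℝ) = 0) : (r : ℝ) = 0 ∧ (s : ℝ) = 0 := by
  by_cases hs : s = 0
  · subst hs
    simpa using h
  · exfalso
    apply sqrt_natCast_ne_ratCast hd (-r / s)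
    have hs' : (s : ℝ) ≠ 0 := by exact_mod_cast hs
    push_cast
    rw [eq_div_iff hs']
    linear_combination h

/-! ### Squares of units in biquadratic fields -/

section Biquadratic

variable {K : IntermediateField ℚ ℝ} {a b : ℕ}

/-- The field enters through an equation so that exchanging a and b gives the conjugation fixing √b
on the same K. -/
lemma exists_conj_biquadraticField (hK : K = biquadraticField a b) (ha : ¬IsSquare a)
    (hb : ¬IsSquare b) (hab : ¬IsSquare (a * b)) (hA : √(a : ℝ) ∈ K) (hB : √(b : ℝ) ∈ K) :
    ∃ σ : K →ₐ[ℚ] ℝ, σ ⟨_, hA⟩ = √(a : ℝ) ∧ σ ⟨_, hB⟩ = -√(b : ℝ) := by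
  subst hK
  obtain ⟨σ, hσ⟩ := exists_conj (quadraticField a) (biquadraticField a b) b
    (sqrt_notMem_quadraticField ha hb hab) (fun x hx => by
      obtain ⟨r, s, t, u, rfl⟩ := mem_biquadraticField hx
      exact ⟨_, add_mul_sqrt_mem_quadraticField a r s, _, add_mul_sqrt_mem_quadraticField a t u,
        by ring⟩)
  refine ⟨σ, ?_, ?_⟩
  · simpa using hσ ⟨_, hA⟩ _ (sqrt_mem_quadraticField a) 0 (zero_mem _) (by simp)
  · simpa using hσ ⟨_, hB⟩ 0 (zero_mem _) 1 (one_mem _) (by simp)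

lemma map_biquadraticField (σ : K →ₐ[ℚ] ℝ) (hA : √(a : ℝ) ∈ K) (hB : √(b : ℝ) ∈ K)
    {A B : ℝ} (h1 : σ ⟨_, hA⟩ = A) (h2 : σ ⟨_, hB⟩ = B) {r s t u : ℚ} {x : ℝ} (hx : x ∈ K)
    (h : x = r + s * √(a : ℝ) + t * √(b : ℝ) + u * (√(a : ℝ) * √(b : ℝ))) :
    σ ⟨x, hx⟩ = r + s * A + t * B + u * (A * B) := by
  have hk : (⟨x, hx⟩ : K) = algebraMap ℚ K r + algebraMap ℚ K s * ⟨_, hA⟩ +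
      algebraMap ℚ K t * ⟨_, hB⟩ + algebraMap ℚ K u * (⟨_, hA⟩ * ⟨_, hB⟩) := Subtype.ext h
  rw [hk]
  simp only [map_add, map_mul, h1, h2, σ.commutes]
  rfl

/-- If `√c` lies in `ℚ(√a, √b)`, then `c` is a square up to a factor `1`, `a`, `b` or `ab`. -/
lemma isSquare_of_sqrt_mem (ha : ¬IsSquare a) (hb : ¬IsSquare b) (hab : ¬IsSquare (a * b))
    {c : ℕ} (hc : √(c : ℝ) ∈ biquadraticField a b) :
    IsSquare c ∨ IsSquare (a * c) ∨ IsSquare (b * c) ∨ IsSquare (a * b * c) := by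
  have hA := sqrt_mem_biquadraticField_left a b
  have hB := sqrt_mem_biquadraticField_right a b
  obtain ⟨σ, hσ1, hσ2⟩ := exists_conj_biquadraticField rfl ha hb hab hA hB
  obtain ⟨τ, hτ2, hτ1⟩ := exists_conj_biquadraticField (biquadraticField_comm a b) hb ha
    (by rwa [mul_comm]) hB hA
  have hsign (ρ : biquadraticField a b →ₐ[ℚ] ℝ) :
      ρ ⟨_, hc⟩ = √(c : ℝ) ∨ ρ ⟨_, hc⟩ = -√(c : ℝ) := by
    apply mul_self_eq_mul_self_iff.1
    rw [← map_mul, natCast_sqrt_mul_self]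
    have : (⟨_, hc⟩ * ⟨_, hc⟩ : biquadraticField a b) = c :=
      Subtype.ext (natCast_sqrt_mul_self c)
    rw [this, map_natCast]
  obtain ⟨r, s, t, u, h⟩ := mem_biquadraticField hc
  have e1 := map_biquadraticField σ hA hB hσ1 hσ2 hc h
  have e2 := map_biquadraticField τ hA hB hτ1 hτ2 hc h
  have hAA := natCast_sqrt_mul_self a
  have hBB := natCast_sqrt_mul_self b
  have pa : √(a : ℝ) ≠ 0 := fun h => sqrt_natCast_ne_ratCast ha 0 (by simpa using h)
  have pb : √(b : ℝ) ≠ 0 := fun h => sqrt_natCast_ne_ratCast hb 0 (by simpa using h)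
  -- A conjugation fixes or negates √c, which kills two of the four coordinates; the two
  -- conjugations together leave a rational multiple of 1, √a, √b or √(ab).
  have d1 : ((r : ℝ) = 0 ∧ (s : ℝ) = 0) ∨ ((t : ℝ) = 0 ∧ (u : ℝ) = 0) := by
    rcases hsign σ with s1 | s1 <;> rw [s1] at e1
    · refine Or.inr (eq_zero_of_add_mul_sqrt_eq_zero ha (mul_left_cancel₀ pb ?_))
      linear_combination (e1 - h) / 2
    · refine Or.inl (eq_zero_of_add_mul_sqrt_eq_zero ha ?_)
      linear_combination (-e1 - h) / 2
  have d2 : ((r : ℝ) = 0 ∧ (t : ℝ) = 0) ∨ ((s : ℝ) = 0 ∧ (u : ℝ) = 0) := by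
    rcases hsign τ with s1 | s1 <;> rw [s1] at e2
    · refine Or.inr (eq_zero_of_add_mul_sqrt_eq_zero hb (mul_left_cancel₀ pa ?_))
      linear_combination (e2 - h) / 2
    · refine Or.inl (eq_zero_of_add_mul_sqrt_eq_zero hb ?_)
      linear_combination (-e2 - h) / 2
  by_contra! hcon
  obtain ⟨n1, n2, n3, n4⟩ := hcon
  rcases d1 with ⟨z1, z2⟩ | ⟨z1, z2⟩ <;> rcases d2 with ⟨z3, z4⟩ | ⟨z3, z4⟩ <;>
    simp only [z1, z2, z3, z4, zero_mul, zero_add, add_zero] at h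
  · apply sqrt_natCast_ne_ratCast n4 (a * b * u)
    rw [Nat.cast_mul, Real.sqrt_mul (by positivity), Nat.cast_mul,
      Real.sqrt_mul (Nat.cast_nonneg a), h]
    push_cast
    linear_combination (u : ℝ) * (√(b : ℝ) * √(b : ℝ)) * hAA + (u : ℝ) * a * hBB
  · apply sqrt_natCast_ne_ratCast n3 (b * t)
    rw [Nat.cast_mul, Real.sqrt_mul (Nat.cast_nonneg b), h]
    push_cast
    linear_combination (t : ℝ) * hBB
  · apply sqrt_natCast_ne_ratCast n2 (a * s)
    rw [Nat.cast_mul, Real.sqrt_mul (Nat.cast_nonneg a), h]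
    push_cast
    linear_combination (s : ℝ) * hAA
  · exact sqrt_natCast_ne_ratCast n1 r h

lemma IsFundamentalUnit.exists_zpow_abs {d : ℕ} {e : ℝ} (h : IsFundamentalUnit d e) {x : ℝ}
    (hx : IsUnitIn (quadraticField d) x) : ∃ n : ℤ, |x| = e ^ n := by
  rcases abs_choice x with h' | h' <;> rw [h']
  · exact h.exists_zpow hx (h' ▸ abs_pos.2 hx.2.1)
  · exact h.exists_zpow hx.neg (h' ▸ abs_pos.2 hx.2.1)

/-- The square of a unit of `ℚ(√a, √b)` is a product of units of the three quadratic subfields. -/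
lemma exists_sq_eq_zpow (ha : ¬IsSquare a) (hb : ¬IsSquare b) (hab : ¬IsSquare (a * b))
    {e₁ e₂ e₃ : ℝ} (h₁ : IsFundamentalUnit a e₁) (h₂ : IsFundamentalUnit b e₂)
    (h₃ : IsFundamentalUnit (a * b) e₃) {y : ℝ} (hy : IsUnitIn (biquadraticField a b) y) :
    ∃ A B C : ℤ, y ^ 2 = e₁ ^ A * e₂ ^ B * e₃ ^ C := by
  have hA := sqrt_mem_biquadraticField_left a b
  have hB := sqrt_mem_biquadraticField_right a b
  obtain ⟨σ, hσ1, hσ2⟩ := exists_conj_biquadraticField rfl ha hb hab hA hB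
  obtain ⟨τ, hτ2, hτ1⟩ := exists_conj_biquadraticField (biquadraticField_comm a b) hb ha
    (by rwa [mul_comm]) hB hA
  obtain ⟨r, s, t, u, h⟩ := mem_biquadraticField hy.1
  have e1 := map_biquadraticField σ hA hB hσ1 hσ2 hy.1 h
  have e2 := map_biquadraticField τ hA hB hτ1 hτ2 hy.1 h
  have hAA := natCast_sqrt_mul_self a
  have hBB := natCast_sqrt_mul_self b
  obtain ⟨i1, i2⟩ := hy.isIntegral_map σ
  obtain ⟨j1, j2⟩ := hy.isIntegral_map τ
  have n1 : σ ⟨y, hy.1⟩ ≠ 0 := fun h0 => hy.2.1 (congrArg Subtype.val ((map_eq_zero σ).1 h0))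
  have n2 : τ ⟨y, hy.1⟩ ≠ 0 := fun h0 => hy.2.1 (congrArg Subtype.val ((map_eq_zero τ).1 h0))
  set y₁ := σ ⟨y, hy.1⟩
  set y₂ := τ ⟨y, hy.1⟩
  have u1 : IsUnitIn (quadraticField a) (y * y₁) := by
    refine ⟨?_, mul_ne_zero hy.2.1 n1, hy.2.2.1.mul i1, by rw [mul_inv]; exact hy.2.2.2.mul i2⟩
    have := add_mul_sqrt_mem_quadraticField a (r ^ 2 + a * s ^ 2 - b * t ^ 2 - a * b * u ^ 2)
      (2 * r * s - 2 * b * t * u)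
    convert this using 1
    rw [e1, h]
    push_cast
    generalize √(a : ℝ) = α at *
    generalize √(b : ℝ) = β at *
    rw [← hAA, ← hBB]
    ring
  have u2 : IsUnitIn (quadraticField b) (y * y₂) := by
    refine ⟨?_, mul_ne_zero hy.2.1 n2, hy.2.2.1.mul j1, by rw [mul_inv]; exact hy.2.2.2.mul j2⟩
    have := add_mul_sqrt_mem_quadraticField b (r ^ 2 + b * t ^ 2 - a * s ^ 2 - a * b * u ^ 2)
      (2 * r * t - 2 * a * s * u)
    convert this using 1
    rw [e2, h]
    push_cast
    generalize √(a : ℝ) = α at *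
    generalize √(b : ℝ) = β at *
    rw [← hAA, ← hBB]
    ring
  have u3 : IsUnitIn (quadraticField (a * b)) (y₁ * y₂) := by
    refine ⟨?_, mul_ne_zero n1 n2, i1.mul j1, by rw [mul_inv]; exact i2.mul j2⟩
    have := add_mul_sqrt_mem_quadraticField (a * b)
      (r ^ 2 - a * s ^ 2 - b * t ^ 2 + a * b * u ^ 2) (2 * s * t - 2 * r * u)
    convert this using 1
    rw [e1, e2, Nat.cast_mul, Real.sqrt_mul (Nat.cast_nonneg a)]
    push_cast
    generalize √(a : ℝ) = α at *
    generalize √(b : ℝ) = β at *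
    rw [← hAA, ← hBB]
    ring
  obtain ⟨A, hA'⟩ := h₁.exists_zpow_abs u1
  obtain ⟨B, hB'⟩ := h₂.exists_zpow_abs u2
  obtain ⟨C, hC'⟩ := h₃.exists_zpow_abs u3
  -- This is y² = (y·y₁)(y·y₂)/(y₁·y₂), with signs absorbed by absolute values.
  refine ⟨A, B, -C, ?_⟩
  rw [zpow_neg, ← hA', ← hB', ← hC', ← div_eq_mul_inv, ← abs_mul, ← abs_div, ← abs_of_nonneg
    (sq_nonneg y)]
  congr 1
  field_simp

/-- The hypotheses on `a`, `b` and the fundamental units `e₁`, `e₂`, `e₃` of `ℚ(√a)`, `ℚ(√b)`,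
`ℚ(√ab)` under which the units of `ℚ(√a, √b)` are determined. -/
structure BiquadraticData (a b : ℕ) (e₁ e₂ e₃ : ℝ) : Prop where
  ha : ¬IsSquare a
  hb : ¬IsSquare b
  hab : ¬IsSquare (a * b)
  h₁ : IsFundamentalUnit a e₁
  h₂ : IsFundamentalUnit b e₂
  h₃ : IsFundamentalUnit (a * b) e₃
  n₁ : HasNorm a e₁ (-1)
  n₂ : HasNorm b e₂ 1
  n₃ : HasNorm (a * b) e₃ 1

namespace BiquadraticData

variable {e₁ e₂ e₃ : ℝ}

lemma sqrt_mul_mem (a b : ℕ) : √((a * b : ℕ) : ℝ) ∈ biquadraticField a b := by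
  rw [Nat.cast_mul, Real.sqrt_mul (Nat.cast_nonneg a)]
  exact mul_mem (sqrt_mem_biquadraticField_left a b) (sqrt_mem_biquadraticField_right a b)

lemma isUnitIn₁ (D : BiquadraticData a b e₁ e₂ e₃) : IsUnitIn (biquadraticField a b) e₁ :=
  D.h₁.isUnitIn.mono (quadraticField_le (sqrt_mem_biquadraticField_left a b))

lemma isUnitIn₂ (D : BiquadraticData a b e₁ e₂ e₃) : IsUnitIn (biquadraticField a b) e₂ :=
  D.h₂.isUnitIn.mono (quadraticField_le (sqrt_mem_biquadraticField_right a b))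

lemma isUnitIn₃ (D : BiquadraticData a b e₁ e₂ e₃) : IsUnitIn (biquadraticField a b) e₃ :=
  D.h₃.isUnitIn.mono (quadraticField_le (sqrt_mul_mem a b))

/-- The conjugation fixing `√a`. -/
lemma exists_conj₁ (D : BiquadraticData a b e₁ e₂ e₃) :
    ∃ σ : biquadraticField a b →ₐ[ℚ] ℝ, σ ⟨e₁, D.isUnitIn₁.1⟩ = e₁ ∧
      σ ⟨e₂, D.isUnitIn₂.1⟩ = e₂⁻¹ ∧ σ ⟨e₃, D.isUnitIn₃.1⟩ = e₃⁻¹ := by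
  have hA := sqrt_mem_biquadraticField_left a b
  have hB := sqrt_mem_biquadraticField_right a b
  obtain ⟨σ, hσ1, hσ2⟩ := exists_conj_biquadraticField rfl D.ha D.hb D.hab hA hB
  have hσ3 : σ ⟨_, sqrt_mul_mem a b⟩ = -√((a * b : ℕ) : ℝ) := by
    rw [map_biquadraticField σ hA hB hσ1 hσ2 (sqrt_mul_mem a b) (r := 0) (s := 0) (t := 0)
      (u := 1) (by simp), Nat.cast_mul, Real.sqrt_mul (Nat.cast_nonneg a)]
    simp
  refine ⟨σ, map_eq_self_of_mem_quadraticField D.h₁.isUnitIn.1 σ hA hσ1 _, ?_, ?_⟩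
  · simpa using D.n₂.conj σ hB hσ2 D.isUnitIn₂.1 D.h₂.pos.ne'
  · simpa using D.n₃.conj σ _ hσ3 D.isUnitIn₃.1 D.h₃.pos.ne'

/-- The conjugation fixing `√b`. -/
lemma exists_conj₂ (D : BiquadraticData a b e₁ e₂ e₃) :
    ∃ σ : biquadraticField a b →ₐ[ℚ] ℝ, σ ⟨e₁, D.isUnitIn₁.1⟩ = -e₁⁻¹ ∧
      σ ⟨e₂, D.isUnitIn₂.1⟩ = e₂ ∧ σ ⟨e₃, D.isUnitIn₃.1⟩ = e₃⁻¹ := by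
  have hA := sqrt_mem_biquadraticField_left a b
  have hB := sqrt_mem_biquadraticField_right a b
  obtain ⟨σ, hσ2, hσ1⟩ := exists_conj_biquadraticField (biquadraticField_comm a b) D.hb D.ha
    (by rw [mul_comm]; exact D.hab) hB hA
  have hσ3 : σ ⟨_, sqrt_mul_mem a b⟩ = -√((a * b : ℕ) : ℝ) := by
    rw [map_biquadraticField σ hA hB hσ1 hσ2 (sqrt_mul_mem a b) (r := 0) (s := 0) (t := 0)
      (u := 1) (by simp), Nat.cast_mul, Real.sqrt_mul (Nat.cast_nonneg a)]
    simp
  refine ⟨σ, ?_, map_eq_self_of_mem_quadraticField D.h₂.isUnitIn.1 σ hB hσ2 _, ?_⟩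
  · simpa using D.n₁.conj σ hA hσ1 D.isUnitIn₁.1 D.h₁.pos.ne'
  · simpa using D.n₃.conj σ _ hσ3 D.isUnitIn₃.1 D.h₃.pos.ne'

lemma map_zpow_prod {K : IntermediateField ℚ ℝ} (σ : K →ₐ[ℚ] ℝ) {x₁ x₂ x₃ y : ℝ} (m₁ : x₁ ∈ K)
    (m₂ : x₂ ∈ K) (m₃ : x₃ ∈ K) (hy : y ∈ K) {A B C : ℤ} (h : y = x₁ ^ A * x₂ ^ B * x₃ ^ C) :
    σ ⟨y, hy⟩ = σ ⟨x₁, m₁⟩ ^ A * σ ⟨x₂, m₂⟩ ^ B * σ ⟨x₃, m₃⟩ ^ C := by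
  have : (⟨y, hy⟩ : K) = ⟨x₁, m₁⟩ ^ A * ⟨x₂, m₂⟩ ^ B * ⟨x₃, m₃⟩ ^ C := by
    apply Subtype.ext
    push_cast
    exact h
  rw [this, map_mul, map_mul, map_zpow₀, map_zpow₀, map_zpow₀]

lemma zpow_eq_one_iff_zero {x : ℝ} (hx : 1 < x) {n : ℤ} (h : x ^ n = 1) : n = 0 :=
  zpow_right_injective₀ (zero_lt_one.trans hx) hx.ne' (by simpa using h)

/-- The three fundamental units are multiplicatively independent. -/
lemma independent (D : BiquadraticData a b e₁ e₂ e₃) {A B C : ℤ}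
    (h : e₁ ^ A * e₂ ^ B * e₃ ^ C = 1) : A = 0 ∧ B = 0 ∧ C = 0 := by
  have p1 := D.h₁.pos.ne'
  have p2 := D.h₂.pos.ne'
  have p3 := D.h₃.pos.ne'
  -- Multiplying the relation by its conjugate over ℚ(√a) cancels e₂ and e₃ and leaves e₁ ^ (2A) =
  -- 1.
  have hA : A = 0 := by
    obtain ⟨σ, s1, s2, s3⟩ := D.exists_conj₁
    have := map_zpow_prod σ D.isUnitIn₁.1 D.isUnitIn₂.1 D.isUnitIn₃.1 (one_mem _) h.symm
    rw [s1, s2, s3] at this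
    have h1 : σ ⟨1, one_mem _⟩ = 1 := map_one σ
    rw [h1, inv_zpow, inv_zpow] at this
    have h2 : e₁ ^ (A + A) = 1 := by
      rw [zpow_add₀ p1]
      calc e₁ ^ A * e₁ ^ A = (e₁ ^ A * e₂ ^ B * e₃ ^ C) *
          (e₁ ^ A * (e₂ ^ B)⁻¹ * (e₃ ^ C)⁻¹) := by
            have := zpow_ne_zero B p2
            have := zpow_ne_zero C p3
            field_simp
        _ = 1 := by rw [h, ← this, one_mul]
    have := zpow_eq_one_iff_zero D.h₁.one_lt h2
    omega
  subst hA
  have hB : B = 0 := by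
    obtain ⟨σ, s1, s2, s3⟩ := D.exists_conj₂
    have := map_zpow_prod σ D.isUnitIn₁.1 D.isUnitIn₂.1 D.isUnitIn₃.1 (one_mem _) h.symm
    rw [s1, s2, s3] at this
    have h1 : σ ⟨1, one_mem _⟩ = 1 := map_one σ
    rw [h1, inv_zpow, zpow_zero, one_mul] at this
    rw [zpow_zero, one_mul] at h
    have h2 : e₂ ^ (B + B) = 1 := by
      rw [zpow_add₀ p2]
      calc e₂ ^ B * e₂ ^ B = (e₂ ^ B * e₃ ^ C) * (e₂ ^ B * (e₃ ^ C)⁻¹) := by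
            have := zpow_ne_zero C p3
            field_simp
        _ = 1 := by rw [h, ← this, one_mul]
    have := zpow_eq_one_iff_zero D.h₂.one_lt h2
    omega
  subst hB
  rw [zpow_zero, zpow_zero, one_mul, one_mul] at h
  exact ⟨rfl, rfl, zpow_eq_one_iff_zero D.h₃.one_lt h⟩

/-- As `e₁` has norm `-1`, it occurs with an even exponent in the square of a unit. -/
lemma exists_sq_eq (D : BiquadraticData a b e₁ e₂ e₃) {y : ℝ}
    (hy : IsUnitIn (biquadraticField a b) y) :
    ∃ A B C : ℤ, y ^ 2 = (e₁ ^ A) ^ 2 * e₂ ^ B * e₃ ^ C := by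
  obtain ⟨A, B, C, h⟩ := exists_sq_eq_zpow D.ha D.hb D.hab D.h₁ D.h₂ D.h₃ hy
  obtain ⟨σ, s1, s2, s3⟩ := D.exists_conj₂
  have hm := map_zpow_prod σ D.isUnitIn₁.1 D.isUnitIn₂.1 D.isUnitIn₃.1 (hy.pow 2).1 h
  have h2 : σ ⟨y ^ 2, (hy.pow 2).1⟩ = σ ⟨y, hy.1⟩ ^ 2 := by rw [← map_pow]; rfl
  rw [h2, s1, s2, s3] at hm
  rcases Int.even_or_odd' A with ⟨n, rfl | rfl⟩
  · exact ⟨n, B, C, by rw [h, ← zpow_natCast, ← zpow_mul]; push_cast; ring_nf⟩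
  -- For an odd exponent the conjugate of y² would be a negative real number, yet it is a square.
  · have hodd : Odd (2 * n + 1) := ⟨n, rfl⟩
    rw [hodd.neg_zpow] at hm
    have p1 : 0 < e₁⁻¹ ^ (2 * n + 1) := zpow_pos (inv_pos.2 D.h₁.pos) _
    have p2 : 0 < e₂ ^ B := zpow_pos D.h₂.pos _
    have p3 : 0 < e₃⁻¹ ^ C := zpow_pos (inv_pos.2 D.h₃.pos) _
    have : 0 < e₁⁻¹ ^ (2 * n + 1) * e₂ ^ B * e₃⁻¹ ^ C := by positivity
    nlinarith [sq_nonneg (σ ⟨y, hy.1⟩)]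

end BiquadraticData
end Biquadratic

/-! ### Fundamental systems, given which products become squares -/

lemma isFSU_three {K : IntermediateField ℚ ℝ} {x₁ x₂ x₃ : ℝ} (h₁ : IsUnitIn K x₁)
    (h₂ : IsUnitIn K x₂) (h₃ : IsUnitIn K x₃) (p₁ : 0 < x₁) (p₂ : 0 < x₂) (p₃ : 0 < x₃)
    (hgen : ∀ y, IsUnitIn K y → 0 < y → ∃ A B C : ℤ, y = x₁ ^ A * x₂ ^ B * x₃ ^ C)
    (hind : ∀ A B C : ℤ, x₁ ^ A * x₂ ^ B * x₃ ^ C = 1 → A = 0 ∧ B = 0 ∧ C = 0) :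
    IsFSU K ![x₁, x₂, x₃] := by
  apply isFSU_of_pos
  · intro i; fin_cases i <;> assumption
  · intro i; fin_cases i <;> assumption
  · intro y hy h0
    obtain ⟨A, B, C, h⟩ := hgen y hy h0
    exact ⟨![A, B, C], by simp [Fin.prod_univ_three, h]⟩
  · intro n hn
    obtain ⟨h0, h1, h2⟩ := hind (n 0) (n 1) (n 2) (by simpa [Fin.prod_univ_three] using hn)
    ext i; fin_cases i <;> assumption

/-- `BiquadraticData` puts the unit of norm -1 first, which is not the order wanted for ℚ(√q, √2p).
-/
lemma IsFSU.swap_first {K : IntermediateField ℚ ℝ} {x₁ x₂ x₃ : ℝ} (h : IsFSU K ![x₁, x₂, x₃]) :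
    IsFSU K ![x₂, x₁, x₃] := by
  obtain ⟨u, hu, hf⟩ := h
  have hs : ![x₂, x₁, x₃] = ![x₁, x₂, x₃] ∘ Equiv.swap 0 1 := by
    ext i; fin_cases i <;> simp [Equiv.swap_apply_of_ne_of_ne]
  refine ⟨u ∘ Equiv.swap 0 1, fun i => by rw [hs]; exact hu _, fun y => ?_⟩
  have hprod (n : Fin 3 → ℤ) :
      ∏ i, (u ∘ Equiv.swap 0 1) i ^ (n ∘ Equiv.swap 0 1) i = ∏ i, u i ^ n i :=
    Equiv.prod_comp (Equiv.swap (0 : Fin 3) 1) fun i => u i ^ n i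
  obtain ⟨⟨ζ, n⟩, h, huniq⟩ := hf y
  refine ⟨(ζ, n ∘ Equiv.swap 0 1), by simp only [hprod]; exact h, ?_⟩
  rintro ⟨ζ', n'⟩ h'
  have hn' : n' = (n' ∘ Equiv.swap 0 1) ∘ Equiv.swap (0 : Fin 3) 1 := by
    ext i; simp
  simp only at h'
  rw [hn', hprod] at h'
  have := huniq (ζ', n' ∘ Equiv.swap 0 1) h'
  rw [Prod.mk.injEq] at this ⊢
  exact ⟨this.1, by rw [hn', this.2]⟩

namespace BiquadraticData

variable {a b : ℕ} {e₁ e₂ e₃ : ℝ}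

/-- If N were odd, dividing y by the other factors would exhibit √e₂ in the field. It is applied
with w = √e₃ and with w = √(e₂e₃). -/
lemma eq_zpow_of_sq_eq (D : BiquadraticData a b e₁ e₂ e₃) (h2 : √e₂ ∉ biquadraticField a b)
    {y w : ℝ} (hy : y ∈ biquadraticField a b) (hy0 : 0 < y) (hw : w ∈ biquadraticField a b)
    (hw0 : 0 < w) {A N C : ℤ} (h : y ^ 2 = (e₁ ^ A) ^ 2 * e₂ ^ N * (w ^ C) ^ 2) :
    ∃ m : ℤ, y = e₁ ^ A * e₂ ^ m * w ^ C := by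
  have p1 : 0 < e₁ ^ A := zpow_pos D.h₁.pos _
  have pw : 0 < w ^ C := zpow_pos hw0 _
  rcases Int.even_or_odd N with ⟨m, rfl⟩ | ⟨m, rfl⟩
  · have p2 : 0 < e₂ ^ m := zpow_pos D.h₂.pos _
    refine ⟨m, (sq_eq_sq₀ hy0.le (by positivity)).1 ?_⟩
    rw [h, zpow_add₀ D.h₂.pos.ne']
    ring
  · have p2 : 0 < e₂ ^ m := zpow_pos D.h₂.pos _
    exfalso
    apply h2
    have hs : √e₂ = y / (e₁ ^ A * e₂ ^ m * w ^ C) := by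
      rw [Real.sqrt_eq_iff_mul_self_eq D.h₂.pos.le (by positivity), ← sq, div_pow, h,
        zpow_add₀ D.h₂.pos.ne', two_mul, zpow_add₀ D.h₂.pos.ne', zpow_one]
      field_simp
    rw [hs]
    exact div_mem hy (mul_mem (mul_mem (zpow_mem D.isUnitIn₁.1 _) (zpow_mem D.isUnitIn₂.1 _))
      (zpow_mem hw _))

lemma sq_zpow_sqrt {e : ℝ} (he : 0 ≤ e) (n : ℤ) : (√e ^ n) ^ 2 = e ^ n := by
  rw [← zpow_natCast, zpow_comm, zpow_natCast, Real.sq_sqrt he]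

lemma sq_zpow {e : ℝ} (n : ℤ) : (e ^ n) ^ 2 = e ^ (2 * n) := by
  rw [← zpow_natCast, ← zpow_mul, mul_comm]; rfl

/-- The case where `e₃` becomes a square, and `e₂` does not. -/
theorem isFSU_sqrt_third (D : BiquadraticData a b e₁ e₂ e₃) (h2 : √e₂ ∉ biquadraticField a b)
    (h3 : √e₃ ∈ biquadraticField a b) : IsFSU (biquadraticField a b) ![e₁, e₂, √e₃] := by
  refine isFSU_three D.isUnitIn₁ D.isUnitIn₂ (D.h₃.isUnitIn.sqrt D.h₃.pos h3) D.h₁.pos D.h₂.pos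
    (Real.sqrt_pos.2 D.h₃.pos) (fun y hy hy0 => ?_) (fun A B C h => ?_)
  · obtain ⟨A, B, C, h⟩ := D.exists_sq_eq hy
    rw [← sq_zpow_sqrt D.h₃.pos.le] at h
    obtain ⟨m, hm⟩ := D.eq_zpow_of_sq_eq h2 hy.1 hy0 h3 (Real.sqrt_pos.2 D.h₃.pos) h
    exact ⟨A, m, C, hm⟩
  · have := congrArg (· ^ 2) h
    simp only [mul_pow, sq_zpow_sqrt D.h₃.pos.le, one_pow, sq_zpow] at this
    obtain ⟨h1, h2, h3⟩ := D.independent this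
    omega

/-- The case where `e₂` and `e₃` become squares. -/
theorem isFSU_sqrt_both (D : BiquadraticData a b e₁ e₂ e₃) (h2 : √e₂ ∈ biquadraticField a b)
    (h3 : √e₃ ∈ biquadraticField a b) : IsFSU (biquadraticField a b) ![e₁, √e₂, √e₃] := by
  refine isFSU_three D.isUnitIn₁ (D.h₂.isUnitIn.sqrt D.h₂.pos h2)
    (D.h₃.isUnitIn.sqrt D.h₃.pos h3) D.h₁.pos (Real.sqrt_pos.2 D.h₂.pos)
    (Real.sqrt_pos.2 D.h₃.pos) (fun y hy hy0 => ?_) (fun A B C h => ?_)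
  · obtain ⟨A, B, C, h⟩ := D.exists_sq_eq hy
    have p1 : 0 < e₁ ^ A := zpow_pos D.h₁.pos _
    have p2 : 0 < √e₂ ^ B := zpow_pos (Real.sqrt_pos.2 D.h₂.pos) _
    have p3 : 0 < √e₃ ^ C := zpow_pos (Real.sqrt_pos.2 D.h₃.pos) _
    refine ⟨A, B, C, (sq_eq_sq₀ hy0.le (by positivity)).1 ?_⟩
    rw [h, mul_pow, mul_pow, sq_zpow_sqrt D.h₂.pos.le, sq_zpow_sqrt D.h₃.pos.le]
  · have := congrArg (· ^ 2) h
    simp only [mul_pow, sq_zpow_sqrt D.h₃.pos.le, sq_zpow_sqrt D.h₂.pos.le, one_pow,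
      sq_zpow] at this
    obtain ⟨h1, h2, h3⟩ := D.independent this
    omega

/-- The case where the product `e₂ e₃` becomes a square, and `e₂` does not. -/
theorem isFSU_sqrt_mul (D : BiquadraticData a b e₁ e₂ e₃) (h2 : √e₂ ∉ biquadraticField a b)
    (h3 : √(e₂ * e₃) ∈ biquadraticField a b) :
    IsFSU (biquadraticField a b) ![e₁, e₂, √(e₂ * e₃)] := by
  have p : 0 < e₂ * e₃ := mul_pos D.h₂.pos D.h₃.pos
  refine isFSU_three D.isUnitIn₁ D.isUnitIn₂ ((D.isUnitIn₂.mul D.isUnitIn₃).sqrt p h3) D.h₁.pos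
    D.h₂.pos (Real.sqrt_pos.2 p) (fun y hy hy0 => ?_) (fun A B C h => ?_)
  · obtain ⟨A, B, C, h⟩ := D.exists_sq_eq hy
    -- Regrouping e₂ ^ B * e₃ ^ C as e₂ ^ (B - C) * (e₂e₃) ^ C.
    have h' : y ^ 2 = (e₁ ^ A) ^ 2 * e₂ ^ (B - C) * (√(e₂ * e₃) ^ C) ^ 2 := by
      have := zpow_ne_zero C D.h₂.pos.ne'
      rw [sq_zpow_sqrt p.le, mul_zpow, h, zpow_sub₀ D.h₂.pos.ne']
      field_simp
    obtain ⟨m, hm⟩ := D.eq_zpow_of_sq_eq h2 hy.1 hy0 h3 (Real.sqrt_pos.2 p) h'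
    exact ⟨A, m, C, hm⟩
  · have := congrArg (· ^ 2) h
    simp only [mul_pow, sq_zpow_sqrt p.le, one_pow, sq_zpow] at this
    have h' : e₁ ^ (2 * A) * e₂ ^ (2 * B + C) * e₃ ^ C = 1 := by
      rw [← this, zpow_add₀ D.h₂.pos.ne', mul_zpow]
      ring
    obtain ⟨h1, h2, h3⟩ := D.independent h'
    omega

end BiquadraticData

/-! ### Which √δ·√e lie in ℚ(√d) -/

/-- The squared denominator of s is coprime to the squared numerator, so it divides the squarefree
d. -/
lemma exists_int_of_mul_sq_eq_int {d : ℕ} (hd : Squarefree d) {s : ℚ} {N : ℤ}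
    (h : d * s ^ 2 = N) : ∃ m : ℤ, s = m := by
  have h1 : (d : ℤ) * s.num ^ 2 = N * (s.den : ℤ) ^ 2 := by
    have hden : (s.den : ℚ) ≠ 0 := by exact_mod_cast s.den_nz
    have : (d : ℚ) * s.num ^ 2 = N * (s.den : ℚ) ^ 2 := by
      rw [← h]
      nth_rw 2 [← Rat.num_div_den s]
      field_simp
    exact_mod_cast this
  have h2 : (s.den : ℤ) ^ 2 ∣ d := by
    have hc : IsCoprime ((s.den : ℤ) ^ 2) (s.num ^ 2) :=
      ((Rat.isCoprime_num_den s).symm).pow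
    exact hc.dvd_of_dvd_mul_right (Dvd.intro_left N h1.symm)
  have h3 : s.den * s.den ∣ d := by rw [← sq]; exact_mod_cast h2
  have h4 : s.den = 1 := Nat.isUnit_iff.1 (hd _ h3)
  exact ⟨s.num, (Rat.den_eq_one_iff s).1 h4 |>.symm⟩

/-- The fundamental unit has norm `1` and a trace `t > 2` with `t² - ds² = 4`, or norm `-1`, and
`-4` has the form `t² - ds²`. -/
lemma IsFundamentalUnit.norm_cases {d : ℕ} {e : ℝ} (hd : ¬IsSquare d) (hsf : Squarefree d)
    (h : IsFundamentalUnit d e) :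
    (HasNorm d e 1 ∧ ∃ n s : ℕ, 0 < n ∧ (n + 4) * n = d * s ^ 2 ∧ (n : ℝ) + 2 = e + e⁻¹) ∨
    (HasNorm d e (-1) ∧ ∃ t s : ℤ, t ^ 2 + 4 = d * s ^ 2) := by
  obtain ⟨r, s, hrs, hn, t, ht⟩ := h.isUnitIn.exists_coords hd
  have hsq : √(d : ℝ) ^ 2 = d := Real.sq_sqrt (Nat.cast_nonneg d)
  rcases hn with hn | hn
  · refine Or.inl ⟨⟨r, s, hrs, hn⟩, ?_⟩
    -- The coordinates r, s may be half-integers; d(2s)² = t² - 4 makes 2s an integer.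
    obtain ⟨m, hm⟩ := exists_int_of_mul_sq_eq_int hsf (s := 2 * s) (N := t ^ 2 - 4)
      (by push_cast; rw [← ht]; linear_combination -4 * hn)
    have hnR : (r : ℝ) ^ 2 - d * (s : ℝ) ^ 2 = 1 := by exact_mod_cast hn
    have htR : 2 * (r : ℝ) = t := by exact_mod_cast ht
    have hinv : e⁻¹ = r - s * √(d : ℝ) := by
      apply inv_eq_of_mul_eq_one_right
      rw [hrs]
      linear_combination hnR - (s : ℝ) ^ 2 * hsq
    have htr : (t : ℝ) = e + e⁻¹ := by rw [hinv, hrs, ← htR]; ring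
    have ht2 : 2 < t := by
      have h1 := h.one_lt
      have h2 : e * e⁻¹ = 1 := mul_inv_cancel₀ h.pos.ne'
      have h3 : e⁻¹ < 1 := inv_lt_one_of_one_lt₀ h1
      have : (2 : ℝ) < t := by rw [htr]; nlinarith
      exact_mod_cast this
    have hm2 : t ^ 2 - 4 = d * m ^ 2 := by
      have : (t : ℚ) ^ 2 - 4 = d * (m : ℚ) ^ 2 := by
        rw [← hm, ← ht]; linear_combination 4 * hn
      exact_mod_cast this
    -- With n = t - 2, the equation t² - 4 = dm² factors as (n + 4)n = dm².
    obtain ⟨n, hn⟩ := Int.eq_ofNat_of_zero_le (a := t - 2) (by omega)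
    refine ⟨n, m.natAbs, by omega, ?_, ?_⟩
    · zify
      rw [sq_abs, ← hm2, ← hn]
      ring
    · rw [← htr]
      have : (n : ℤ) + 2 = t := by omega
      exact_mod_cast this
  · refine Or.inr ⟨⟨r, s, hrs, hn⟩, t, ?_⟩
    obtain ⟨m, hm⟩ := exists_int_of_mul_sq_eq_int hsf (s := 2 * s) (N := t ^ 2 + 4)
      (by push_cast; rw [← ht]; linear_combination -4 * hn)
    refine ⟨m, ?_⟩
    have : (t : ℚ) ^ 2 + 4 = d * (m : ℚ) ^ 2 := by
      rw [← hm, ← ht]; linear_combination 4 * hn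
    exact_mod_cast this

/-- A prime factor of the squarefree part of `W`, where `WV = ds²`, divides `d` or both `W`
and `V`. -/
lemma prime_dvd_of_dvd_squarefree_part {W V d s b δ r : ℕ} (hW : W ≠ 0) (hV : V ≠ 0)
    (h : W * V = d * s ^ 2) (hb : b ^ 2 * δ = W) (hδ : Squarefree δ) (hr : r.Prime)
    (hrδ : r ∣ δ) : r ∣ d ∨ r ∣ V := by
  by_contra! hcon
  obtain ⟨h1, h2⟩ := hcon
  have hds : d * s ^ 2 ≠ 0 := h ▸ mul_ne_zero hW hV
  have hd0 := left_ne_zero_of_mul hds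
  have hs0 := right_ne_zero_of_mul hds
  have hb' : b ^ 2 * δ ≠ 0 := hb ▸ hW
  -- If r divides neither d nor V, its exponent in W is even by WV = ds², but odd by W = b²δ.
  have e1 := congrArg (fun n => n.factorization r) h
  have e2 := congrArg (fun n => n.factorization r) hb
  simp only [Nat.factorization_mul hW hV, Nat.factorization_mul hd0 hs0,
    Nat.factorization_mul (left_ne_zero_of_mul hb') (right_ne_zero_of_mul hb'),
    Nat.factorization_pow, Finsupp.add_apply, Finsupp.smul_apply, smul_eq_mul,
    Nat.factorization_eq_zero_of_not_dvd h1, Nat.factorization_eq_zero_of_not_dvd h2] at e1 e2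
  have e3 := hδ.natFactorization_le_one r
  have e4 := (hr.dvd_iff_one_le_factorization hδ.ne_zero).1 hrδ
  omega

lemma Nat.dvd_of_squarefree_of_forall_prime {δ n : ℕ} (hδ : Squarefree δ) (hn : n ≠ 0)
    (h : ∀ r : ℕ, r.Prime → r ∣ δ → r ∣ n) : δ ∣ n := by
  rw [← Nat.prod_primeFactors_of_squarefree hδ]
  refine (Finset.prod_dvd_prod_of_subset _ _ _ fun r hr => ?_).trans (Nat.prod_primeFactors_dvd n)
  rw [Nat.mem_primeFactors] at hr ⊢
  exact ⟨hr.1, h r hr.1 hr.2.1, hn⟩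

/-- For `p ≡ 5 (mod 8)` and `p ∣ d`, one of the factors in `(n + 4) n = ds²` is a square, possibly
up to the prime `q` of which `p` is a quadratic residue. -/
lemma exists_factor_eq_sq {p q d n s : ℕ} [Fact p.Prime] (hp : p % 8 = 5)
    (hq : ∀ y, y ∣ q → y = 1 ∨ y = q) (hq0 : q ≠ 0) (hqp : IsSquare (q : ZMod p)) (hpd : p ∣ d)
    (hd : ∀ r : ℕ, r.Prime → r ∣ d → r = p ∨ r ∣ 2 * q) (hn : 0 < n)
    (h : (n + 4) * n = d * s ^ 2) :
    ∃ W b δ : ℕ, (W = n + 4 ∨ W = n) ∧ W = b ^ 2 * δ ∧ (δ = 1 ∨ δ = q) := by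
  have hpp : p.Prime := Fact.out
  have h4 : ((4 : ℕ) : ZMod p) ≠ 0 := by
    rw [Ne, ZMod.natCast_eq_zero_iff]
    intro hd4
    have := (Nat.prime_dvd_prime_iff_eq hpp Nat.prime_two).1 (hpp.dvd_of_dvd_pow (n := 2) hd4)
    omega
  have hneg : IsSquare (-1 : ZMod p) := ZMod.exists_sq_eq_neg_one_iff.2 (by omega)
  have hfour : IsSquare ((4 : ℕ) : ZMod p) := ⟨2, by norm_num⟩
  -- W is the factor not divisible by p: it is 4 or -4 mod p, a square since p ≡ 1 (mod 4). A common
  -- divisor of W and V divides their difference 4.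
  obtain ⟨W, V, hWn, hWV, hW0, hV0, hdvd, hWsq, hWne⟩ : ∃ W V : ℕ, (W = n + 4 ∨ W = n) ∧
      W * V = d * s ^ 2 ∧ W ≠ 0 ∧ V ≠ 0 ∧ (∀ r, r ∣ W → r ∣ V → r ∣ 4) ∧
      IsSquare (W : ZMod p) ∧ (W : ZMod p) ≠ 0 := by
    rcases hpp.dvd_mul.1 (h ▸ hpd.mul_right _ : p ∣ (n + 4) * n) with h1 | h1
    · have hc : (n : ZMod p) = -1 * ((4 : ℕ) : ZMod p) := by
        have := (ZMod.natCast_eq_zero_iff _ _).2 h1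
        push_cast at this ⊢
        linear_combination this
      refine ⟨n, n + 4, Or.inr rfl, by rw [mul_comm, h], by omega, by omega,
        fun r a b => (Nat.dvd_add_right a).1 b, ?_, ?_⟩
      · rw [hc]; exact hneg.mul hfour
      · rw [hc, neg_one_mul]; exact neg_ne_zero.2 h4
    · have hc : ((n + 4 : ℕ) : ZMod p) = ((4 : ℕ) : ZMod p) := by
        rw [Nat.cast_add, (ZMod.natCast_eq_zero_iff _ _).2 h1, zero_add]
      refine ⟨n + 4, n, Or.inl rfl, h, by omega, by omega,
        fun r a b => (Nat.dvd_add_right b).1 a, ?_, ?_⟩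
      · rw [hc]; exact hfour
      · rw [hc]; exact h4
  obtain ⟨δ, b, hb, hδ⟩ := Nat.sq_mul_squarefree W
  have hWc : (b : ZMod p) ^ 2 * δ = W := by exact_mod_cast congrArg (Nat.cast (R := ZMod p)) hb
  have hbδ : (b : ZMod p) ^ 2 * δ ≠ 0 := hWc ▸ hWne
  have hb0 : (b : ZMod p) ^ 2 ≠ 0 := left_ne_zero_of_mul hbδ
  have hδ0 : (δ : ZMod p) ≠ 0 := right_ne_zero_of_mul hbδ
  have hδsq : IsSquare (δ : ZMod p) := by
    have : (δ : ZMod p) = W / (b : ZMod p) ^ 2 := by rw [← hWc, mul_div_cancel_left₀ _ hb0]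
    rw [this]
    exact hWsq.div (IsSquare.sq _)
  have hδdvd : δ ∣ 2 * q := by
    refine Nat.dvd_of_squarefree_of_forall_prime hδ (by omega) fun r hr hrδ => ?_
    have hrW : r ∣ W := hb ▸ hrδ.mul_left _
    rcases prime_dvd_of_dvd_squarefree_part hW0 hV0 hWV hb hδ hr hrδ with h1 | h1
    · rcases hd r hr h1 with rfl | h2
      · exact absurd ((ZMod.natCast_eq_zero_iff _ _).2 hrδ) hδ0
      · exact h2
    · have := (Nat.prime_dvd_prime_iff_eq hr Nat.prime_two).1
        (hr.dvd_of_dvd_pow (n := 2) (hdvd r hrW h1))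
      rw [this]
      exact dvd_mul_right _ _
  refine ⟨W, b, δ, hWn, hb.symm, ?_⟩
  obtain ⟨x, y, hx, hy, rfl⟩ := Nat.dvd_mul.1 hδdvd
  have hysq : IsSquare (y : ZMod p) := by
    rcases hq y hy with rfl | rfl
    · simp
    · exact hqp
  rcases (Nat.dvd_prime Nat.prime_two).1 hx with rfl | rfl
  · simpa using hq y hy
  -- An even δ would make 2 a square mod p, against p ≡ 5 (mod 8).
  · exfalso
    rw [Nat.cast_mul] at hδ0 hδsq
    have hy0 := right_ne_zero_of_mul hδ0
    have h2 : IsSquare (2 : ZMod p) := by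
      have := hδsq.div hysq
      rwa [mul_div_cancel_right₀ _ hy0] at this
    have := (ZMod.exists_sq_eq_two_iff (by omega)).1 h2
    omega

/-- From e + e⁻¹ = n + 2 follow (n + 4)e = (e + 1)² and ne = (e - 1)², so √W·√e is e + 1 or e - 1.
-/
lemma IsFundamentalUnit.sqrt_mul_sqrt_mem {d : ℕ} {e : ℝ} (h : IsFundamentalUnit d e)
    {n b δ W : ℕ} (hn : 0 < n) (hne : (n : ℝ) + 2 = e + e⁻¹) (hW : W = n + 4 ∨ W = n)
    (hWb : W = b ^ 2 * δ) : √(δ : ℝ) * √e ∈ quadraticField d := by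
  have h0 := h.pos
  have he := h.isUnitIn.1
  have h1 : √(W : ℝ) * √e ∈ quadraticField d := by
    rw [← Real.sqrt_mul (Nat.cast_nonneg W)]
    rcases hW with rfl | rfl
    · have : ((n + 4 : ℕ) : ℝ) * e = (e + 1) ^ 2 := by
        push_cast
        have : (n : ℝ) = e + e⁻¹ - 2 := by linarith
        rw [this]
        field_simp
        ring
      rw [this, Real.sqrt_sq (by linarith)]
      exact add_mem he (one_mem _)
    · have : (W : ℝ) * e = (e - 1) ^ 2 := by
        have : (W : ℝ) = e + e⁻¹ - 2 := by linarith
        rw [this]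
        field_simp
        ring
      rw [this, Real.sqrt_sq (by linarith [h.one_lt])]
      exact sub_mem he (one_mem _)
  have hb0 : (b : ℝ) ≠ 0 := by
    rintro hb
    have : b = 0 := by exact_mod_cast hb
    subst this
    omega
  have h2 : √(W : ℝ) = b * √(δ : ℝ) := by
    rw [hWb, Nat.cast_mul, Nat.cast_pow, Real.sqrt_mul (by positivity),
      Real.sqrt_sq (Nat.cast_nonneg b)]
  have h3 : √(δ : ℝ) * √e = √(W : ℝ) * √e / b := by rw [h2]; field_simp
  rw [h3]
  exact div_mem h1 (natCast_mem _ b)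

/-- The fundamental unit of `ℚ(√d)` has norm `-1` if `d` is `p`, or twice `p`, with
`p ≡ 5 (mod 8)`. -/
lemma hasNorm_neg_one {p d : ℕ} {e : ℝ} [Fact p.Prime] (hp : p % 8 = 5) (hpd : p ∣ d)
    (hd : ∀ r : ℕ, r.Prime → r ∣ d → r = p ∨ r ∣ 2) (hsq : ¬IsSquare d) (hsf : Squarefree d)
    (h : IsFundamentalUnit d e) : HasNorm d e (-1) := by
  rcases h.norm_cases hsq hsf with ⟨-, n, s, hn, hns, hne⟩ | ⟨h, -⟩
  · exfalso
    -- The choice q = 1 leaves only δ = 1, which would put √e in ℚ(√d).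
    obtain ⟨W, b, δ, hW, hWb, hδ⟩ := exists_factor_eq_sq (q := 1) hp
      (fun y hy => Or.inl (Nat.dvd_one.1 hy)) one_ne_zero (by simp) hpd (by simpa using hd) hn hns
    have := h.sqrt_mul_sqrt_mem hn hne hW hWb
    rw [or_self] at hδ
    rw [hδ, Nat.cast_one, Real.sqrt_one, one_mul] at this
    exact h.sqrt_notMem this
  · exact h

/-- A fundamental unit of `ℚ(√d)` of norm `1`, where `d` is `pq` or `2pq`, becomes a square on
adjoining `√q`. -/
lemma sqrt_mul_sqrt_mem_of_residue {p q d : ℕ} {e : ℝ} [Fact p.Prime] (hp : p % 8 = 5)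
    (hq : q.Prime) (hqp : IsSquare (q : ZMod p)) (hpd : p ∣ d)
    (hd : ∀ r : ℕ, r.Prime → r ∣ d → r = p ∨ r ∣ 2 * q) (h : IsFundamentalUnit d e) {n s : ℕ}
    (hn : 0 < n) (hns : (n + 4) * n = d * s ^ 2) (hne : (n : ℝ) + 2 = e + e⁻¹) :
    √(q : ℝ) * √e ∈ quadraticField d := by
  obtain ⟨W, b, δ, hW, hWb, hδ⟩ := exists_factor_eq_sq hp
    (fun y hy => (Nat.dvd_prime hq).1 hy) hq.ne_zero hqp hpd hd hn hns
  have := h.sqrt_mul_sqrt_mem hn hne hW hWb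
  rcases hδ with rfl | rfl
  · rw [Nat.cast_one, Real.sqrt_one, one_mul] at this
    exact absurd this h.sqrt_notMem
  · exact this

lemma mem_of_mul_mem_left {K : IntermediateField ℚ ℝ} {x y : ℝ} (hx : x ∈ K) (hx0 : x ≠ 0)
    (h : x * y ∈ K) : y ∈ K := by
  have := div_mem h hx
  rwa [mul_div_cancel_left₀ _ hx0] at this

lemma sqrt_natCast_ne_zero {n : ℕ} (hn : n ≠ 0) : √(n : ℝ) ≠ 0 :=
  (Real.sqrt_pos.2 (by positivity)).ne'

/-- A fundamental unit of norm `1` of `ℚ(√q)` or `ℚ(√2q)` becomes a square on adjoining `√2`. -/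
lemma sqrt_two_mul_sqrt_mem {q d : ℕ} {e : ℝ} (hq : q.Prime) (hd : d = q ∨ d = 2 * q)
    (h : IsFundamentalUnit d e) {n s : ℕ}
    (hn : 0 < n) (hns : (n + 4) * n = d * s ^ 2) (hne : (n : ℝ) + 2 = e + e⁻¹) :
    √(2 : ℝ) * √e ∈ quadraticField d := by
  obtain ⟨δ, b, hb, hδ⟩ := Nat.sq_mul_squarefree (n + 4)
  have hmem := h.sqrt_mul_sqrt_mem hn hne (Or.inl rfl) hb.symm
  have hd2 : d ∣ 2 * q := by rcases hd with rfl | rfl <;> simp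
  have hδdvd : δ ∣ 2 * q := by
    refine Nat.dvd_of_squarefree_of_forall_prime hδ (by have := hq.pos; omega) fun r hr hrδ => ?_
    have hrW : r ∣ n + 4 := hb ▸ hrδ.mul_left _
    rcases prime_dvd_of_dvd_squarefree_part (by omega) (by omega) hns hb hδ hr hrδ with h1 | h1
    · exact h1.trans hd2
    · have := (Nat.prime_dvd_prime_iff_eq hr Nat.prime_two).1
        (hr.dvd_of_dvd_pow (n := 2) ((Nat.dvd_add_right h1).1 hrW))
      rw [this]
      exact dvd_mul_right _ _
  have hs := sqrt_mem_quadraticField d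
  have hq0 := sqrt_natCast_ne_zero hq.ne_zero
  have hd0 : √(d : ℝ) ≠ 0 := by
    have := hq.pos
    exact sqrt_natCast_ne_zero (by rcases hd with rfl | rfl <;> omega)
  have hqq := natCast_sqrt_mul_self q
  have h22 : √(2 : ℝ) * √2 = 2 := Real.mul_self_sqrt zero_le_two
  obtain ⟨x, y, hx, hy, rfl⟩ := Nat.dvd_mul.1 hδdvd
  rw [Nat.cast_mul, Real.sqrt_mul (Nat.cast_nonneg x)] at hmem
  -- Of δ = 1, q, 2, 2q, those equal to 1 or d would put √e in ℚ(√d); the other two agree with 2 up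
  -- to a factor d and squares.
  rcases (Nat.dvd_prime Nat.prime_two).1 hx with rfl | rfl <;>
    rcases (Nat.dvd_prime hq).1 hy with rfl | rfl <;>
    simp only [Nat.cast_one, Real.sqrt_one, one_mul, mul_one, Nat.cast_ofNat] at hmem
  · exact absurd hmem h.sqrt_notMem
  · rcases hd with rfl | rfl
    · exact absurd (mem_of_mul_mem_left hs hq0 hmem) h.sqrt_notMem
    · refine mem_of_mul_mem_left (natCast_mem _ y) (by exact_mod_cast hq.ne_zero) ?_
      have := mul_mem hs hmem
      convert this using 1
      rw [Nat.cast_mul, Real.sqrt_mul (by positivity), Nat.cast_ofNat]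
      linear_combination (-(√(2 : ℝ) * √e)) * hqq
  · exact hmem
  · rcases hd with rfl | rfl
    · refine mem_of_mul_mem_left hs hq0 ?_
      convert hmem using 1
      ring
    · refine absurd (mem_of_mul_mem_left hs hd0 ?_) h.sqrt_notMem
      convert hmem using 1
      rw [Nat.cast_mul, Real.sqrt_mul (by positivity), Nat.cast_ofNat]

/-- The fundamental unit of `ℚ(√d)` has norm `1` if `d` has a prime factor `q ≡ 3 (mod 4)`. -/
lemma IsFundamentalUnit.norm_one {q d : ℕ} {e : ℝ} [Fact q.Prime] (hq : q % 4 = 3) (hqd : q ∣ d)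
    (hd : ¬IsSquare d) (hsf : Squarefree d) (h : IsFundamentalUnit d e) :
    HasNorm d e 1 ∧ ∃ n s : ℕ, 0 < n ∧ (n + 4) * n = d * s ^ 2 ∧ (n : ℝ) + 2 = e + e⁻¹ := by
  rcases h.norm_cases hd hsf with h | ⟨-, t, s, hts⟩
  · exact h
  · exfalso
    have h2 : (2 : ZMod q) ≠ 0 := by
      have : ((2 : ℕ) : ZMod q) ≠ 0 := by
        rw [Ne, ZMod.natCast_eq_zero_iff, Nat.prime_dvd_prime_iff_eq Fact.out Nat.prime_two]
        omega
      exact_mod_cast this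
    -- Norm -1 would make -1 a square mod q.
    have hc : (t : ZMod q) ^ 2 = -2 ^ 2 := by
      have h3 := congrArg (Int.cast (R := ZMod q)) hts
      push_cast at h3
      rw [(ZMod.natCast_eq_zero_iff d q).2 hqd] at h3
      linear_combination h3
    exact ZMod.mod_four_ne_three_of_sq_eq_neg_sq' h2 hc hq

/-- The fundamental unit of `ℚ(√2)` has norm `-1`. -/
lemma hasNorm_neg_one_two {e : ℝ} (h : IsFundamentalUnit 2 e) : HasNorm 2 e (-1) := by
  rcases h.norm_cases Nat.prime_two.prime.not_isSquare Nat.prime_two.squarefree with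
    ⟨-, n, s, hn, hns, hne⟩ | ⟨h, -⟩
  · exfalso
    obtain ⟨δ, b, hb, hδ⟩ := Nat.sq_mul_squarefree (n + 4)
    have hmem := h.sqrt_mul_sqrt_mem hn hne (Or.inl rfl) hb.symm
    have hδdvd : δ ∣ 2 := by
      refine Nat.dvd_of_squarefree_of_forall_prime hδ two_ne_zero fun r hr hrδ => ?_
      have hrW : r ∣ n + 4 := hb ▸ hrδ.mul_left _
      rcases prime_dvd_of_dvd_squarefree_part (by omega) (by omega) hns hb hδ hr hrδ with h1 | h1
      · exact h1
      · exact hr.dvd_of_dvd_pow (n := 2) ((Nat.dvd_add_right h1).1 hrW)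
    rcases (Nat.dvd_prime Nat.prime_two).1 hδdvd with rfl | rfl
    · rw [Nat.cast_one, Real.sqrt_one, one_mul] at hmem
      exact h.sqrt_notMem hmem
    · exact h.sqrt_notMem (mem_of_mul_mem_left (sqrt_mem_quadraticField 2)
        (sqrt_natCast_ne_zero two_ne_zero) hmem)
  · exact h

/-! ### The five biquadratic fields -/

lemma Nat.Prime.not_isSquare_mul {r m : ℕ} (hr : r.Prime) (h : ¬r ∣ m) : ¬IsSquare (r * m) := by
  rintro ⟨k, hk⟩
  have h1 : r ∣ k := by
    rcases hr.dvd_mul.1 (hk ▸ dvd_mul_right r m) with h | h <;> exact h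
  obtain ⟨l, rfl⟩ := h1
  apply h
  refine ⟨l * l, Nat.eq_of_mul_eq_mul_left hr.pos ?_⟩
  rw [hk]
  ring

theorem mainTheorem6 (p q : ℕ) [Fact p.Prime] [Fact q.Prime]
    (hp : p ≡ 5 [MOD 8]) (hq : q ≡ 3 [MOD 8]) (hpq : legendreSym q (p : ℤ) = 1) :
    IsFSU (biquadraticField p q)
      ![fundamentalUnit p, fundamentalUnit q, √(fundamentalUnit (p * q))] ∧
    IsFSU (biquadraticField 2 q)
      ![fundamentalUnit 2, √(fundamentalUnit q), √(fundamentalUnit (2 * q))] ∧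
    IsFSU (biquadraticField p (2 * q))
      ![fundamentalUnit p, fundamentalUnit (2 * q),
        √(fundamentalUnit (2 * q) * fundamentalUnit (2 * p * q))] ∧
    IsFSU (biquadraticField q (2 * p))
      ![fundamentalUnit q, fundamentalUnit (2 * p), √(fundamentalUnit (2 * p * q))] ∧
    IsFSU (biquadraticField 2 (p * q))
      ![fundamentalUnit 2, fundamentalUnit (p * q),
        √(fundamentalUnit (p * q) * fundamentalUnit (2 * p * q))] := by
  have hpp : p.Prime := Fact.out
  have hqp : q.Prime := Fact.out
  have hp8 : p % 8 = 5 := hp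
  have hq8 : q % 8 = 3 := hq
  have hq4 : q % 4 = 3 := by omega
  have p2 : ¬p ∣ 2 := fun h => by
    have := (Nat.prime_dvd_prime_iff_eq hpp Nat.prime_two).1 h; omega
  have q2 : ¬q ∣ 2 := fun h => by
    have := (Nat.prime_dvd_prime_iff_eq hqp Nat.prime_two).1 h; omega
  have pq : ¬p ∣ q := fun h => by
    have := (Nat.prime_dvd_prime_iff_eq hpp hqp).1 h; omega
  have qp : ¬q ∣ p := fun h => by
    have := (Nat.prime_dvd_prime_iff_eq hqp hpp).1 h; omega
  have tp : ¬2 ∣ p := by omega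
  have tq : ¬2 ∣ q := by omega
  have q1 : ¬q ∣ 1 := hqp.one_lt.ne' ∘ Nat.dvd_one.1
  -- Quadratic reciprocity, with p ≡ 1 (mod 4).
  have residue : IsSquare (q : ZMod p) := by
    have h1 : legendreSym p q = 1 := by
      rw [← legendreSym.quadratic_reciprocity_one_mod_four (by omega) (by omega)]
      exact hpq
    have h0 : ((q : ℤ) : ZMod p) ≠ 0 := fun h => by
      rw [(legendreSym.eq_zero_iff p q).2 h] at h1
      exact zero_ne_one h1
    simpa using (legendreSym.eq_one_iff p h0).1 h1
  -- the radicands are not squares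
  have sp : ¬IsSquare p := hpp.prime.not_isSquare
  have sq : ¬IsSquare q := hqp.prime.not_isSquare
  have s2 : ¬IsSquare 2 := Nat.prime_two.prime.not_isSquare
  have spq : ¬IsSquare (p * q) := hpp.not_isSquare_mul pq
  have s2p : ¬IsSquare (2 * p) := Nat.prime_two.not_isSquare_mul tp
  have s2q : ¬IsSquare (2 * q) := Nat.prime_two.not_isSquare_mul tq
  have tpq : ¬2 ∣ p * q := by rw [Nat.prime_two.dvd_mul]; tauto
  have s2pq : ¬IsSquare (2 * p * q) := by
    rw [mul_assoc]; exact Nat.prime_two.not_isSquare_mul tpq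
  have cpq : p.Coprime q := (Nat.Prime.coprime_iff_not_dvd hpp).2 pq
  have c2q : Nat.Coprime 2 q := (Nat.Prime.coprime_iff_not_dvd Nat.prime_two).2 tq
  have c2p : Nat.Coprime 2 p := (Nat.Prime.coprime_iff_not_dvd Nat.prime_two).2 tp
  have f2p : Squarefree (2 * p) :=
    (Nat.squarefree_mul c2p).2 ⟨Nat.prime_two.squarefree, hpp.prime.squarefree⟩
  have f2q : Squarefree (2 * q) :=
    (Nat.squarefree_mul c2q).2 ⟨Nat.prime_two.squarefree, hqp.prime.squarefree⟩
  have fpq : Squarefree (p * q) :=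
    (Nat.squarefree_mul cpq).2 ⟨hpp.prime.squarefree, hqp.prime.squarefree⟩
  have f2pq : Squarefree (2 * p * q) :=
    (Nat.squarefree_mul (c2q.mul_left cpq)).2 ⟨f2p, hqp.prime.squarefree⟩
  -- the fundamental units and their norms
  have up := isFundamentalUnit_fundamentalUnit sp
  have uq := isFundamentalUnit_fundamentalUnit sq
  have u2 := isFundamentalUnit_fundamentalUnit s2
  have upq := isFundamentalUnit_fundamentalUnit spq
  have u2p := isFundamentalUnit_fundamentalUnit s2p
  have u2q := isFundamentalUnit_fundamentalUnit s2q
  have u2pq := isFundamentalUnit_fundamentalUnit s2pq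
  have np := hasNorm_neg_one hp8 dvd_rfl
    (fun r hr h => Or.inl ((Nat.prime_dvd_prime_iff_eq hr hpp).1 h)) sp hpp.prime.squarefree up
  have n2p := hasNorm_neg_one hp8 (dvd_mul_left _ _)
    (fun r hr h => (hr.dvd_mul.1 h).symm.imp (Nat.prime_dvd_prime_iff_eq hr hpp).1 id) s2p f2p u2p
  have n2 := hasNorm_neg_one_two u2
  obtain ⟨nq, n, s, hn, hns, hne⟩ := uq.norm_one hq4 dvd_rfl sq hqp.prime.squarefree
  have mq := sqrt_two_mul_sqrt_mem hqp (Or.inl rfl) uq hn hns hne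
  obtain ⟨n2q, n, s, hn, hns, hne⟩ := u2q.norm_one hq4 (dvd_mul_left _ _) s2q f2q
  have m2q := sqrt_two_mul_sqrt_mem hqp (Or.inr rfl) u2q hn hns hne
  obtain ⟨npq, n, s, hn, hns, hne⟩ := upq.norm_one hq4 (dvd_mul_left _ _) spq fpq
  have mpq := sqrt_mul_sqrt_mem_of_residue hp8 hqp residue (dvd_mul_right _ _)
    (fun r hr h => (hr.dvd_mul.1 h).imp (Nat.prime_dvd_prime_iff_eq hr hpp).1
      fun h => h.mul_left _) upq hn hns hne
  obtain ⟨n2pq, n, s, hn, hns, hne⟩ := u2pq.norm_one hq4 (dvd_mul_left _ _) s2pq f2pq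
  have m2pq := sqrt_mul_sqrt_mem_of_residue hp8 hqp residue
    (by rw [mul_right_comm]; exact dvd_mul_left _ _)
    (fun r hr h => by
      rw [mul_right_comm] at h
      exact (hr.dvd_mul.1 h).symm.imp (Nat.prime_dvd_prime_iff_eq hr hpp).1 id) u2pq hn hns hne
  clear hn hns hne n s
  have r2 : √(2 : ℝ) ≠ 0 := by positivity
  have rq : √(q : ℝ) ≠ 0 := sqrt_natCast_ne_zero hqp.ne_zero
  -- transfer between `√e` and the radicand
  have transfer {K : IntermediateField ℚ ℝ} {x y : ℝ} (h : x * y ∈ K) (hy : y ≠ 0) (hm : y ∈ K) :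
      x ∈ K := mem_of_mul_mem_left hm hy (by rwa [mul_comm])
  have e1 : p * (2 * q) = 2 * p * q := by ring
  have e2 : 2 * p * q = 2 * (p * q) := by ring
  have pos {d : ℕ} {e : ℝ} (h : IsFundamentalUnit d e) : √e ≠ 0 := (Real.sqrt_pos.2 h.pos).ne'
  refine ⟨?_, ?_, ?_, ?_, ?_⟩
  · have D : BiquadraticData p q _ _ _ := ⟨sp, sq, spq, up, uq, upq, np, nq, npq⟩
    have l2 := quadraticField_le (sqrt_mem_biquadraticField_right p q)
    have l3 := quadraticField_le (BiquadraticData.sqrt_mul_mem p q)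
    refine D.isFSU_sqrt_third (fun h => ?_)
      (mem_of_mul_mem_left (sqrt_mem_biquadraticField_right p q) rq (l3 mpq))
    -- Since √2·√ε_q lies in ℚ(√q), having √ε_q in the field would put √2 there too.
    have h2 := transfer (l2 mq) (pos uq) h
    rcases isSquare_of_sqrt_mem sp sq spq (c := 2) (by exact_mod_cast h2) with h | h | h | h
    · exact s2 h
    · exact hpp.not_isSquare_mul p2 h
    · exact hqp.not_isSquare_mul q2 h
    · rw [mul_comm] at h
      exact Nat.prime_two.not_isSquare_mul tpq h
  · have D : BiquadraticData 2 q _ _ _ := ⟨s2, sq, s2q, u2, uq, u2q, n2, nq, n2q⟩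
    have l2 := quadraticField_le (sqrt_mem_biquadraticField_right 2 q)
    have l3 := quadraticField_le (BiquadraticData.sqrt_mul_mem 2 q)
    have h2 : √(2 : ℝ) ∈ biquadraticField 2 q := by
      exact_mod_cast sqrt_mem_biquadraticField_left 2 q
    exact D.isFSU_sqrt_both (mem_of_mul_mem_left h2 r2 (l2 mq))
      (mem_of_mul_mem_left h2 r2 (l3 m2q))
  · have D : BiquadraticData p (2 * q) _ _ _ := ⟨sp, s2q, by rwa [e1], up, u2q,
      by rw [e1]; exact u2pq, np, n2q, by rw [e1]; exact n2pq⟩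
    have hB := sqrt_mem_biquadraticField_right p (2 * q)
    have l2 := quadraticField_le hB
    have l3 := quadraticField_le (BiquadraticData.sqrt_mul_mem p (2 * q))
    rw [e1] at l3
    refine D.isFSU_sqrt_mul (fun h => ?_) ?_
    · have h2 := transfer (l2 m2q) (pos u2q) h
      rcases isSquare_of_sqrt_mem sp s2q (by rwa [e1]) (c := 2) (by exact_mod_cast h2) with
        h | h | h | h
      · exact s2 h
      · exact hpp.not_isSquare_mul p2 h
      · rw [mul_comm 2, mul_assoc] at h
        exact hqp.not_isSquare_mul (by rw [hqp.dvd_mul]; tauto) h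
      · rw [mul_assoc] at h
        exact hpp.not_isSquare_mul (by simp only [hpp.dvd_mul]; tauto) h
    -- √(2q)·√(ε_2q ε_2pq) is the product of √2·√ε_2q and √q·√ε_2pq.
    · refine mem_of_mul_mem_left hB (sqrt_natCast_ne_zero (by have := hqp.pos; omega)) ?_
      rw [Real.sqrt_mul u2q.pos.le]
      convert mul_mem (l2 m2q) (l3 m2pq) using 1
      rw [Nat.cast_mul, Real.sqrt_mul (Nat.cast_nonneg 2), Nat.cast_ofNat]
      ring
  · have D : BiquadraticData (2 * p) q _ _ _ := ⟨s2p, sq, s2pq, u2p, uq, u2pq, n2p, nq, n2pq⟩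
    have hB := sqrt_mem_biquadraticField_right (2 * p) q
    have l2 := quadraticField_le hB
    have l3 := quadraticField_le (BiquadraticData.sqrt_mul_mem (2 * p) q)
    rw [biquadraticField_comm]
    refine (D.isFSU_sqrt_third (fun h => ?_) (mem_of_mul_mem_left hB rq (l3 m2pq))).swap_first
    have h2 := transfer (l2 mq) (pos uq) h
    rcases isSquare_of_sqrt_mem s2p sq s2pq (c := 2) (by exact_mod_cast h2) with h | h | h | h
    · exact s2 h
    · rw [mul_comm 2, mul_assoc] at h
      exact hpp.not_isSquare_mul (by rw [hpp.dvd_mul]; tauto) h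
    · exact hqp.not_isSquare_mul q2 h
    · rw [mul_comm 2, mul_assoc, mul_assoc] at h
      exact hpp.not_isSquare_mul (by simp only [hpp.dvd_mul]; tauto) h
  · have D : BiquadraticData 2 (p * q) _ _ _ := ⟨s2, spq, by rwa [← e2], u2, upq,
      by rw [← e2]; exact u2pq, n2, npq, by rw [← e2]; exact n2pq⟩
    have l2 := quadraticField_le (sqrt_mem_biquadraticField_right 2 (p * q))
    have l3 := quadraticField_le (BiquadraticData.sqrt_mul_mem 2 (p * q))
    rw [← e2] at l3
    refine D.isFSU_sqrt_mul (fun h => ?_) ?_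
    -- Here the obstruction is √q, which is not in ℚ(√2, √pq).
    · have h2 := transfer (l2 mpq) (pos upq) h
      rcases isSquare_of_sqrt_mem s2 spq (by rwa [← e2]) h2 with h | h | h | h
      · exact sq h
      · exact s2q h
      · rw [mul_assoc] at h
        exact hpp.not_isSquare_mul (by rw [hpp.dvd_mul]; tauto) h
      · rw [mul_assoc] at h
        exact Nat.prime_two.not_isSquare_mul (by simp only [Nat.prime_two.dvd_mul]; tauto) h
    -- Both roots carry the same factor √q, so their product carries only the rational factor q.
    · refine mem_of_mul_mem_left (natCast_mem _ q) (Nat.cast_ne_zero.2 hqp.ne_zero) ?_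
      rw [Real.sqrt_mul upq.pos.le]
      convert mul_mem (l2 mpq) (l3 m2pq) using 1
      linear_combination
        (-(√(fundamentalUnit (p * q)) * √(fundamentalUnit (2 * p * q)))) * natCast_sqrt_mul_self q
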